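/- **Theorem 4.1.** Let $n\ge 1$, let $\mu$ be Lebesgue measure on $\mathbb R^n$ and let $\operatorname{ci}(A)$ be the closure of the interior of $A$. Let $\mathfrak J_n$ be the collection of regular compact Jordan measurable sets, i.e. bounded sets $A\subseteq\mathbb R^n$ with $A=\operatorname{ci}(A)$ and $\mu(\partial A)=0$, and let $d_\mu(A,B)=\mu(A\,\Delta\,B)$. *Construction of the measure average.* Fix once and for all a number $N>1$, a number $\varepsilon>0$, and a choice of a centre for every set that has one, where a centre of $E$ is a point $q_E\in E$ with $d_S(q_E,E)=\sup_{a\in E}d_S(a,E)$. Here $d_S(p,E)$ is the signed distance: $d(p,\partial E)$ if $p\in E$ and $-d(p,\partial E)$ if $p\notin E$. (0) For $x\in\mathbb R$ and $E\supseteq B$, $E\ne\emptyset$, put $f_{E,B,x}(p)=x\,d_S(p,E)+(1-x)\,d_S(p,B)$, where $d_S(p,B)$ is replaced by $-\|p-q_E\|$ if $B=\emptyset$. Put $xE\,\widetilde\oplus\,(1-x)B=\{p: f_{E,B,x}(p)\ge 0\}$ and $h(x)=\mu\big(xE\,\widetilde\oplus\,(1-x)B\big)$. The pair $E,B$ satisfies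 the zero-measure condition if $\mu(\{f_{E,B,1/2}=0\})=0$. (1) *Simple average* of $E\supseteq B$, for $t\in\mathbb R$. If the zero-measure condition holds or $t\notin[0,1]$, it is $\operatorname{ci}\big(gE\,\widetilde\oplus\,(1-g)B\big)$, where $g$ is any minimizer over $\xi\in[-N,N]$ of $\big|h(\xi)-(t\mu(E)+(1-t)\mu(B))\big|$. Otherwise it is $\operatorname{ci}(O(B,r)\cap E)$, where $O(B,r)=\{p:d(p,B)\le r\}$ and $r\ge0$ is any number with $\mu(O(B,r)\cap E)=t\mu(E)+(1-t)\mu(B)$. (2) *Nested sets* $B\subseteq A$ in $\mathfrak J_n$. If $A=B$, put $tA\oplus(1-t)B=A$. Otherwise let $\mathcal P$ be the set of connected components of $A\setminus B$ if there are finitely many; if there are infinitely many, let $\mathcal P$ consist of the components of measure at least $\varepsilon$ and of the union of all the other components. For $C\in\mathcal P$ let $R_{C,t}$ be the simple average of $B\cup C$ and $B$ with parameter $t$. Then $tA\oplus(1-t)B$ is $\bigcup_{C\in\mathcal P}R_{C,t}$ if $t\ge0$ and $\operatorname{ci}\big(\bigcap_{C\in\mathcal P}R_{C,t}\big)$ if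 $t<0$. (3) *General sets* $A,B\in\mathfrak J_n$. With the nested averages $R_{1,t}=tA\oplus(1-t)\operatorname{ci}(A\cap B)$ and $R_{2,t}=(1-t)B\oplus t\operatorname{ci}(A\cap B)$, $$tA\oplus(1-t)B=\begin{cases}R_{1,t}\cup R_{2,t}, & t\in[0,1],\\ \operatorname{ci}\big(R_{1,t}\setminus(A\cap B)\big)\cup R_{2,t}, & t>1,\\ (1-t)B\oplus tA, & t<0,\end{cases}$$ where for $t<0$ the right-hand side is given by the second case, with $B,A,1-t$ in place of $A,B,t$. *Claim.* For all $A,B\in\mathfrak J_n$ and all $t\in\mathbb R$ the measure average $tA\oplus(1-t)B$ is well defined: admissible parameters $g$, $r$ exist wherever they are needed, and the resulting set does not depend on which of them are used. Moreover, for all $s,t\in\mathbb R$: 1. (closure) $tA\oplus(1-t)B\in\mathfrak J_n$; 2. (interpolation) $0A\oplus1B=B$ and $1A\oplus0B=A$; 3. (submetric) $d_\mu\big(sA\oplus(1-s)B,\;tA\oplus(1-t)B\big)\le|t-s|\,d_\mu(A,B)$; and, for all $s,t\in[0,1]$: 4. (measure) $\mu\big(tA\oplus(1-t)B\big)=t\mu(A)+(1-t)\mu(B)$;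 5. (metric) $d_\mu\big(sA\oplus(1-s)B,\;tA\oplus(1-t)B\big)=|t-s|\,d_\mu(A,B)$; 6. (inclusion) $\operatorname{ci}(A\cap B)\subseteq tA\oplus(1-t)B\subseteq A\cup B$. -/

import Mathlib

noncomputable section

namespace MeasureAverage

open MeasureTheory Set

/-- Euclidean space of dimension `n`, with the Euclidean norm and Lebesgue measure `volume`. -/
abbrev Space (n : ℕ) : Type := EuclideanSpace ℝ (Fin n)

variable {n : ℕ}

/-- The closure of the interior of a set. -/
def ci (A : Set (Space n)) : Set (Space n) := closure (interior A)

/-- The class of regular compact Jordan measurable sets: bounded sets that are the closure of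
their interior and whose boundary is a Lebesgue null set. -/
structure IsRegularCompactJordan (A : Set (Space n)) : Prop where
  isBounded : Bornology.IsBounded A
  eq_ci : A = ci A
  volume_frontier : volume (frontier A) = 0

/-- The measure of the symmetric difference. -/
def dMu (A B : Set (Space n)) : ℝ := volume.real (symmDiff A B)

open Classical in
/-- The signed distance of `p` to a (non-empty) set `A`: the distance to the boundary of `A`,
with a positive sign in `A` and a negative sign outside `A`. -/
def signedDist (A : Set (Space n)) (p : Space n) : ℝ :=
  if p ∈ A then Metric.infDist p (frontier A) else -Metric.infDist p (frontier A)

/-- `q` is a centre of `A`: a point of `A` at which the signed distance to `A` is maximal on `A`. -/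
def IsCenter (A : Set (Space n)) (q : Space n) : Prop :=
  q ∈ A ∧ ∀ a ∈ A, signedDist A a ≤ signedDist A q

/-- `c` selects a centre of every set that has one. -/
def IsCenterChoice (c : Set (Space n) → Space n) : Prop :=
  ∀ A, (∃ q, IsCenter A q) → IsCenter A (c A)

open Classical in
/-- The signed distance to `A` that is used when `A` is averaged with `B`. If `A` is empty, it is
minus the distance to the selected centre of `B`. -/
def relDist (c : Set (Space n) → Space n) (A B : Set (Space n)) (p : Space n) : ℝ :=
  if A = ∅ then -dist p (c B) else signedDist A p

/-- The weighted average of the signed distances to `A` and `B`, with weights `x` and `1 - x`. -/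
def avgFun (c : Set (Space n) → Space n) (x : ℝ) (A B : Set (Space n)) (p : Space n) : ℝ :=
  x * relDist c A B p + (1 - x) * relDist c B A p

open Classical in
/-- The distance average of `A` and `B` with weights `x` and `1 - x`. -/
def distAvg (c : Set (Space n) → Space n) (x : ℝ) (A B : Set (Space n)) : Set (Space n) :=
  if A = ∅ ∧ B = ∅ then ∅ else {p | 0 ≤ avgFun c x A B p}

/-- The zero-measure condition. -/
def ZeroMeasureCondition (c : Set (Space n) → Space n) (A B : Set (Space n)) : Prop :=
  volume {p | avgFun c (1 / 2) A B p = 0} = 0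

/-- `x` minimizes over `[-N, N]` the distance of the measure of the distance average with weights
`x`, `1 - x` to the average of the measures of `A` and `B` with weights `t`, `1 - t`. -/
def IsReparam (c : Set (Space n) → Space n) (N t : ℝ) (A B : Set (Space n)) (x : ℝ) : Prop :=
  x ∈ Icc (-N) N ∧
    IsMinOn
      (fun ξ => |volume.real (distAvg c ξ A B) - (t * volume.real A + (1 - t) * volume.real B)|)
      (Icc (-N) N) x

/-- `S` is a measure average of `A` and `B ⊆ A`, with weights `t` and `1 - t`, by the formulas for
simply different sets. If the zero-measure condition holds or `t ∉ [0, 1]`, it is a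
reparametrization of the distance average; otherwise it is obtained by intersecting `A` with a
closed `r`-neighbourhood of `B`. Every admissible parameter `x` or `r` is allowed here. -/
def IsSimpleAvg (c : Set (Space n) → Space n) (N t : ℝ) (A B S : Set (Space n)) : Prop :=
  ((ZeroMeasureCondition c A B ∨ t ∉ Icc (0 : ℝ) 1) ∧
    ∃ x, IsReparam c N t A B x ∧ S = ci (distAvg c x A B)) ∨
  ((¬ ZeroMeasureCondition c A B ∧ t ∈ Icc (0 : ℝ) 1) ∧
    ∃ r, 0 ≤ r ∧
      volume.real (Metric.cthickening r B ∩ A) = t * volume.real A + (1 - t) * volume.real B ∧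
      S = ci (Metric.cthickening r B ∩ A))

/-- The collection of the connected components of `D`. -/
def components (D : Set (Space n)) : Set (Set (Space n)) :=
  {C | ∃ p ∈ D, C = connectedComponentIn D p}

open Classical in
/-- The pieces of `A \ B`: its connected components if there are finitely many of them; otherwise
the components of measure at least `ε`, together with the union of all the other components, which
is treated as a single component. -/
def pieces (ε : ℝ) (A B : Set (Space n)) : Set (Set (Space n)) :=
  if (components (A \ B)).Finite then components (A \ B)
  else {C | C ∈ components (A \ B) ∧ ENNReal.ofReal ε ≤ volume C} ∪
    {⋃₀ {C | C ∈ components (A \ B) ∧ volume C < ENNReal.ofReal ε}}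

open Classical in
/-- `S` is a measure average of the nested sets `B ⊆ A` with weights `t` and `1 - t`. -/
def IsNestedAvg (c : Set (Space n) → Space n) (N ε t : ℝ) (A B S : Set (Space n)) : Prop :=
  if A = B then S = A
  else ∃ R : Set (Space n) → Set (Space n),
    (∀ C ∈ pieces ε A B, IsSimpleAvg c N t (B ∪ C) B (R C)) ∧
    S = if 0 ≤ t then ⋃ C ∈ pieces ε A B, R C else ci (⋂ C ∈ pieces ε A B, R C)

open Classical in
/-- `S` is a measure average of `A` and `B` with weights `t ≥ 0` and `1 - t`. -/
def IsNonnegAvg (c : Set (Space n) → Space n) (N ε t : ℝ) (A B S : Set (Space n)) : Prop :=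
  ∃ R₁ R₂ : Set (Space n),
    IsNestedAvg c N ε t A (ci (A ∩ B)) R₁ ∧
    IsNestedAvg c N ε (1 - t) B (ci (A ∩ B)) R₂ ∧
    S = if t ≤ 1 then R₁ ∪ R₂ else ci (R₁ \ (A ∩ B)) ∪ R₂

open Classical in
/-- `S` is a measure average `t A ⊕ (1 - t) B`, for some admissible values of the parameters in the
construction. For `t < 0` it is `(1 - t) B ⊕ t A`. -/
def IsMeasureAvg (c : Set (Space n) → Space n) (N ε t : ℝ) (A B S : Set (Space n)) : Prop :=
  if t < 0 then IsNonnegAvg c N ε (1 - t) B A S else IsNonnegAvg c N ε t A B S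

end MeasureAverage

end

noncomputable section

namespace MeasureAverage

open MeasureTheory Set Filter Topology

variable {n : ℕ}

/-! ### Distances to the frontier -/

/-! For nested `B ⊆ E` the signed distance to `E` dominates that to `B` (`IsSimplePair.relDist_le`),
so the weighted average `f_x` increases with `x` and the distance averages `{f_x ≥ 0}` are nested.
Two of them with the same finite measure therefore agree almost everywhere, and `ci` turns almost
everywhere equality of sets with null frontier into equality (`ci_subset_ci_of_ae_le`). Hence only
the measure attained matters, not the parameter that attains it.

Existence of parameters is the intermediate value theorem for `h(x) = μ{f_x ≥ 0}`, and continuity of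
`h` at `x` follows once `{f_x = 0}` is null. For `x ≠ 1/2` one weight dominates in absolute value.
Off the null zero set of the dominating function, moving towards a nearest zero changes that
function at unit speed, and the other one, being 1-Lipschitz, cannot compensate. So `f_x` grows
linearly at its zeros, which Rademacher's theorem allows only on a null set
(`volume_linear_comb_eq_zero`). At `x = 1/2` the zero-measure condition is needed. If it fails, `t ∈
[0, 1]` is served by neighbourhoods of `B`, while `t ∉ [0, 1]` only needs `h` on `[-N, 0]` or `[1,
N]`. The measure attained is the target clamped to the range of `h` on `[-N, N]`, and clamping is
nonexpansive.

The outcome is an increasing family from `B` to `ci E` whose measure grows at most at the linear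
rate (`IsAvgFamily`). This passes to nested pairs: the pieces are finitely many, each `B ∪ C` has
its frontier in `∂A ∪ ∂B`, and the measures of the pieces add up. For general `A`, `B` one nested
family grows while the other shrinks, and their rates add up to `d_μ(A, B)`, which is the submetric
bound. On `[0, 1]` the bound is an equality by the triangle inequality, because the endpoints `B`
and `A` are exactly `d_μ(A, B)` apart. -/

lemma exists_frontier_mem_segment {X : Set (Space n)} {p z : Space n} (hp : p ∈ X)
    (hz : z ∉ interior X) : ∃ w ∈ segment ℝ p z, w ∈ frontier X := by
  by_contra! h
  have hcov : segment ℝ p z ⊆ interior X ∪ interior Xᶜ := by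
    intro w hw
    have := h w hw
    rw [frontier_eq_closure_inter_closure, mem_inter_iff, not_and_or, closure_compl] at this
    rcases this with h1 | h1
    · right; rwa [interior_compl]
    · left; simpa using h1
  have hpi : p ∈ interior X := by
    rcases hcov (left_mem_segment ℝ p z) with h1 | h1
    · exact h1
    · exact absurd hp (interior_subset h1)
  have hzi : z ∈ interior Xᶜ := (hcov (right_mem_segment ℝ p z)).resolve_left hz
  obtain ⟨w, -, hw1, hw2⟩ := (convex_segment (𝕜 := ℝ) p z).isPreconnected _ _ isOpen_interior
    isOpen_interior hcov ⟨p, left_mem_segment ℝ p z, hpi⟩ ⟨z, right_mem_segment ℝ p z, hzi⟩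
  exact interior_subset hw2 (interior_subset hw1)

lemma infDist_frontier_le {X : Set (Space n)} {p z : Space n} (hp : p ∈ X)
    (hz : z ∉ interior X) : Metric.infDist p (frontier X) ≤ dist p z := by
  obtain ⟨w, hw, hwX⟩ := exists_frontier_mem_segment hp hz
  have h1 := dist_add_dist_of_mem_segment hw
  have h2 := Metric.infDist_le_dist_of_mem (x := p) hwX
  have h3 : 0 ≤ dist w z := dist_nonneg
  linarith

/-- This is where positive dimension enters. With an empty frontier `infDist` would take its default
value `0` and the signed distance would carry no information. -/
lemma frontier_nonempty_of_isBounded [NeZero n] {X : Set (Space n)} (hX : X.Nonempty)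
    (hb : Bornology.IsBounded X) : (frontier X).Nonempty := by
  rw [nonempty_frontier_iff]
  refine ⟨hX, ?_⟩
  rintro rfl
  exact NormedSpace.unbounded_univ ℝ (Space n) hb

lemma abs_signedDist (X : Set (Space n)) (p : Space n) :
    |signedDist X p| = Metric.infDist p (frontier X) := by
  unfold signedDist
  split_ifs
  · exact abs_of_nonneg Metric.infDist_nonneg
  · rw [abs_neg]; exact abs_of_nonneg Metric.infDist_nonneg

lemma signedDist_sub_eq_add {X : Set (Space n)} {p q : Space n} (hp : p ∈ X) (hq : q ∉ X) :
    signedDist X p - signedDist X q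
      = Metric.infDist p (frontier X) + Metric.infDist q (frontier X) := by
  simp [signedDist, hp, hq]

/-- Only `p` inside and `q` outside needs an argument: the segment meets the frontier at some `w`,
and both distances to the frontier are bounded by the two parts into which `w` cuts the segment. -/
lemma signedDist_sub_le (X : Set (Space n)) (p q : Space n) :
    signedDist X p - signedDist X q ≤ dist p q := by
  by_cases hp : p ∈ X <;> by_cases hq : q ∈ X
  · simp only [signedDist, hp, hq, if_true]
    have := Metric.infDist_le_infDist_add_dist (s := frontier X) (x := p) (y := q)
    linarith
  · rw [signedDist_sub_eq_add hp hq]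
    obtain ⟨w, hw, hwX⟩ := exists_frontier_mem_segment hp (fun h => hq (interior_subset h))
    have h1 := dist_add_dist_of_mem_segment hw
    have h2 := Metric.infDist_le_dist_of_mem (x := p) hwX
    have h3 := Metric.infDist_le_dist_of_mem (x := q) hwX
    rw [dist_comm q w] at h3
    linarith
  · have h1 : 0 ≤ Metric.infDist p (frontier X) := Metric.infDist_nonneg
    have h2 : 0 ≤ Metric.infDist q (frontier X) := Metric.infDist_nonneg
    have h3 : 0 ≤ dist p q := dist_nonneg
    simp only [signedDist, hp, hq, if_true, if_false]
    linarith
  · simp only [signedDist, hp, hq, if_false]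
    have := Metric.infDist_le_infDist_add_dist (s := frontier X) (x := q) (y := p)
    rw [dist_comm] at this
    linarith

lemma abs_signedDist_sub_le (X : Set (Space n)) (p q : Space n) :
    |signedDist X p - signedDist X q| ≤ dist p q := by
  rw [abs_le]
  have h1 := signedDist_sub_le X p q
  have h2 := signedDist_sub_le X q p
  rw [dist_comm] at h2
  constructor <;> linarith

lemma signedDist_eq_zero_iff {X : Set (Space n)} (hX : (frontier X).Nonempty) {p : Space n} :
    signedDist X p = 0 ↔ p ∈ frontier X := by
  rw [← abs_eq_zero, abs_signedDist, isClosed_frontier.mem_iff_infDist_zero hX]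

lemma signedDist_nonneg_iff {X : Set (Space n)} (hX : (frontier X).Nonempty) {p : Space n} :
    0 ≤ signedDist X p ↔ p ∈ closure X := by
  by_cases hp : p ∈ X
  · simp [signedDist, hp, Metric.infDist_nonneg, subset_closure hp]
  · have h0 : signedDist X p ≤ 0 := by simp [signedDist, hp, Metric.infDist_nonneg]
    have : 0 ≤ signedDist X p ↔ signedDist X p = 0 := ⟨fun h => le_antisymm h0 h, fun h => h.ge⟩
    rw [this, signedDist_eq_zero_iff hX, frontier, Set.mem_sdiff]
    exact ⟨fun h => h.1, fun h => ⟨h, fun h' => hp (interior_subset h')⟩⟩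

lemma signedDist_pos_iff {X : Set (Space n)} (hX : (frontier X).Nonempty) {p : Space n} :
    0 < signedDist X p ↔ p ∈ interior X := by
  rw [lt_iff_le_and_ne, signedDist_nonneg_iff hX, ne_comm, Ne, signedDist_eq_zero_iff hX, frontier,
    Set.mem_sdiff]
  constructor
  · rintro ⟨h1, h2⟩
    by_contra h
    exact h2 ⟨h1, h⟩
  · exact fun h => ⟨subset_closure (interior_subset h), fun h' => h'.2 h⟩

/-- Inside `X`, a nearest frontier point of `Y` is not interior to `X`, so the frontier of `X` is at
least as close. Outside `Y`, the same argument applies to the complements. -/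
lemma signedDist_mono {X Y : Set (Space n)} (hXY : X ⊆ Y) (hX : (frontier X).Nonempty)
    (hY : (frontier Y).Nonempty) (p : Space n) : signedDist X p ≤ signedDist Y p := by
  by_cases hpX : p ∈ X
  · have hpY := hXY hpX
    simp only [signedDist, hpX, hpY, if_true]
    obtain ⟨z, hz, hzd⟩ := isClosed_frontier.exists_infDist_eq_dist hY p
    rw [hzd]
    exact infDist_frontier_le hpX fun h => hz.2 (interior_mono hXY h)
  · by_cases hpY : p ∈ Y
    · have h1 : 0 ≤ Metric.infDist p (frontier X) := Metric.infDist_nonneg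
      have h2 : 0 ≤ Metric.infDist p (frontier Y) := Metric.infDist_nonneg
      simp only [signedDist, hpX, hpY, if_true, if_false]
      linarith
    · simp only [signedDist, hpX, hpY, if_false, neg_le_neg_iff]
      obtain ⟨z, hz, hzd⟩ := isClosed_frontier.exists_infDist_eq_dist hX p
      rw [hzd, ← frontier_compl]
      refine infDist_frontier_le (X := Yᶜ) hpY ?_
      rw [interior_compl]
      exact fun h => h (closure_mono hXY hz.1)

/-! ### Functions of unit speed off their zeros -/

/-- `F` is `1`-Lipschitz, and off its zero set it changes with speed at least one in some
direction. -/
structure IsEikonal (F : Space n → ℝ) : Prop where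
  abs_sub_le : ∀ p q, |F p - F q| ≤ dist p q
  exists_dir : ∀ p, F p ≠ 0 → ∃ v : Space n, ‖v‖ = 1 ∧
    ∀ᶠ δ : ℝ in 𝓝[>] 0, δ ≤ |F (p + δ • v) - F p|

lemma IsEikonal.continuous {F : Space n → ℝ} (hF : IsEikonal F) : Continuous F := by
  refine (LipschitzWith.of_dist_le_mul (K := 1) fun p q => ?_).continuous
  simpa [Real.dist_eq] using hF.abs_sub_le p q

lemma exists_unit_toward {p z : Space n} (h : p ≠ z) :
    ∃ v : Space n, ‖v‖ = 1 ∧ z = p + dist p z • v := by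
  have hd : dist p z ≠ 0 := dist_ne_zero.2 h
  have hd' : ‖z - p‖ ≠ 0 := by rwa [← dist_eq_norm, dist_comm]
  refine ⟨(dist p z)⁻¹ • (z - p), ?_, ?_⟩
  · rw [norm_smul, norm_inv, dist_comm, dist_eq_norm, norm_norm, inv_mul_cancel₀ hd']
  · rw [smul_smul, mul_inv_cancel₀ hd, one_smul]; abel

lemma dist_add_smul_unit {p v : Space n} (hv : ‖v‖ = 1) {s δ : ℝ} (h : δ ≤ s) :
    dist (p + δ • v) (p + s • v) = s - δ := by
  rw [dist_add_left, dist_comm, dist_eq_norm, ← sub_smul, norm_smul, hv, mul_one,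
    Real.norm_of_nonneg (by linarith)]

/-- The direction is the one towards a nearest frontier point, along which the distance to the
frontier drops at unit speed. -/
lemma isEikonal_signedDist {X : Set (Space n)} (hX : (frontier X).Nonempty) :
    IsEikonal (signedDist X) := by
  refine ⟨abs_signedDist_sub_le X, fun p hp => ?_⟩
  obtain ⟨z, hz, hzd⟩ := isClosed_frontier.exists_infDist_eq_dist hX p
  have hne : p ≠ z := by
    rintro rfl
    exact hp ((signedDist_eq_zero_iff hX).2 hz)
  obtain ⟨v, hv, hzv⟩ := exists_unit_toward hne
  have hs : 0 < dist p z := dist_pos.2 hne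
  refine ⟨v, hv, ?_⟩
  filter_upwards [Ioo_mem_nhdsGT hs] with δ hδ
  have h1 : Metric.infDist (p + δ • v) (frontier X) ≤ dist p z - δ := by
    refine (Metric.infDist_le_dist_of_mem hz).trans_eq ?_
    conv_lhs => rw [hzv]
    exact dist_add_smul_unit hv hδ.2.le
  have h2 := abs_sub_abs_le_abs_sub (signedDist X p) (signedDist X (p + δ • v))
  rw [abs_signedDist, abs_signedDist, abs_sub_comm, hzd] at h2
  linarith

lemma isEikonal_neg_dist (q : Space n) : IsEikonal fun p => -dist p q := by
  refine ⟨fun p p' => ?_, fun p hp => ?_⟩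
  · rw [show -dist p q - -dist p' q = dist p' q - dist p q by ring, dist_comm p p']
    exact abs_dist_sub_le _ _ _
  · have hne : p ≠ q := by rintro rfl; simp at hp
    obtain ⟨v, hv, hzv⟩ := exists_unit_toward hne
    have hs : 0 < dist p q := dist_pos.2 hne
    refine ⟨v, hv, ?_⟩
    filter_upwards [Ioo_mem_nhdsGT hs] with δ hδ
    have h1 : dist (p + δ • v) q = dist p q - δ := by
      conv_lhs => rw [hzv]
      exact dist_add_smul_unit hv hδ.2.le
    rw [h1]
    refine le_trans (le_of_eq ?_) (le_abs_self _)
    ring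

/-! ### Null level sets -/

/-- By Rademacher's theorem, a Lipschitz function has linear growth only at almost none of its
zeros. -/
lemma volume_zeros_eq_zero {g : Space n → ℝ} {K : NNReal} (hg : LipschitzWith K g)
    {Z : Set (Space n)} (h0 : ∀ p ∈ Z, g p = 0)
    (hZ : ∀ p ∈ Z, ∃ v : Space n, ∃ c > 0, ∀ᶠ δ : ℝ in 𝓝[>] 0, c * δ ≤ |g (p + δ • v)|) :
    volume Z = 0 := by
  have hL : LipschitzWith K fun p => |g p| := by
    refine LipschitzWith.of_dist_le_mul fun p q => ?_
    rw [Real.dist_eq]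
    exact (abs_abs_sub_abs_le_abs_sub _ _).trans ((Real.dist_eq _ _).symm.le.trans (hg.dist_le_mul p q))
  have hae := hL.ae_differentiableAt (μ := volume)
  refine measure_mono_null (fun p hp => ?_) hae
  intro hd
  -- A zero of `g` minimizes `|g|`, so a derivative of `|g|` there must vanish, against the linear
  -- growth along `v`.
  have hmin : IsLocalMin (fun p => |g p|) p := by
    refine Filter.Eventually.of_forall fun q => ?_
    simp [h0 p hp]
  obtain ⟨v, c, hc, hv⟩ := hZ p hp
  have hderiv := hd.hasFDerivAt
  rw [hmin.fderiv_eq_zero] at hderiv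
  have hlin : HasDerivAt (fun δ : ℝ => p + δ • v) v 0 := by
    simpa using ((hasDerivAt_id (0 : ℝ)).smul_const v).const_add p
  have hcomp : HasDerivAt (fun δ : ℝ => |g (p + δ • v)|) 0 0 := by
    have := HasFDerivAt.comp_hasDerivAt (x := (0 : ℝ)) (l := fun p => |g p|)
      (f := fun δ : ℝ => p + δ • v) (l' := 0) (f' := v) (by simpa using hderiv) hlin
    exact this
  have hlim := hcomp.tendsto_slope_zero_right
  have hge : ∀ᶠ δ : ℝ in 𝓝[>] 0, c ≤ δ⁻¹ • (|g (p + (0 + δ) • v)| - |g (p + (0 : ℝ) • v)|) := by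
    filter_upwards [hv, self_mem_nhdsWithin] with δ hδ hpos
    have hpos' : (0 : ℝ) < δ := hpos
    simp only [zero_add, zero_smul, add_zero, h0 p hp, abs_zero, sub_zero, smul_eq_mul]
    rw [inv_mul_eq_div, le_div_iff₀ hpos']
    exact hδ
  exact absurd (ge_of_tendsto hlim hge) (not_le.2 hc)

lemma lipschitzWith_linear_comb {F G : Space n → ℝ} (hF : ∀ p q, |F p - F q| ≤ dist p q)
    (hG : ∀ p q, |G p - G q| ≤ dist p q) (a b k : ℝ) :
    LipschitzWith (Real.nnabs a + Real.nnabs b) fun p => a * F p + b * G p + k := by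
  refine LipschitzWith.of_dist_le_mul fun p q => ?_
  rw [Real.dist_eq, show a * F p + b * G p + k - (a * F q + b * G q + k)
    = a * (F p - F q) + b * (G p - G q) by ring]
  refine (abs_add_le _ _).trans ?_
  rw [abs_mul, abs_mul, NNReal.coe_add, Real.coe_nnabs, Real.coe_nnabs, add_mul]
  gcongr
  · exact hF p q
  · exact hG p q

/-- Along the direction in which `F` has speed at least one, `a F` moves by at least `|a| δ` and `b
G` by at most `|b| δ`, leaving growth of at least `(|a| - |b|) δ` at every zero of the combination
with `F ≠ 0`. -/
lemma volume_linear_comb_eq_zero {F G : Space n → ℝ} (hF : IsEikonal F)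
    (hF0 : volume {p | F p = 0} = 0) (hG : ∀ p q, |G p - G q| ≤ dist p q) {a b : ℝ}
    (hab : |b| < |a|) (k : ℝ) : volume {p | a * F p + b * G p + k = 0} = 0 := by
  have hsub : {p | a * F p + b * G p + k = 0} ⊆
      {p | F p = 0} ∪ {p | a * F p + b * G p + k = 0 ∧ F p ≠ 0} := by
    intro p hp
    by_cases h : F p = 0
    · exact Or.inl h
    · exact Or.inr ⟨hp, h⟩
  refine measure_mono_null hsub (measure_union_null hF0 ?_)
  refine volume_zeros_eq_zero (lipschitzWith_linear_comb hF.abs_sub_le hG a b k) (fun p hp => hp.1) ?_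
  rintro p ⟨hp, hFp⟩
  obtain ⟨v, hv, hδ⟩ := hF.exists_dir p hFp
  refine ⟨v, |a| - |b|, by linarith, ?_⟩
  filter_upwards [hδ, self_mem_nhdsWithin] with δ h1 hpos
  have hpos' : (0 : ℝ) < δ := hpos
  have h2 : |G (p + δ • v) - G p| ≤ δ := by
    refine (hG _ _).trans_eq ?_
    rw [dist_eq_norm, add_sub_cancel_left, norm_smul, hv, mul_one, Real.norm_of_nonneg hpos'.le]
  have h3 : a * F (p + δ • v) + b * G (p + δ • v) + k
      = a * (F (p + δ • v) - F p) - -(b * (G (p + δ • v) - G p)) := by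
    have hp' : a * F p + b * G p + k = 0 := hp
    linear_combination hp'
  rw [h3]
  have h4 := abs_sub_abs_le_abs_sub (a * (F (p + δ • v) - F p)) (-(b * (G (p + δ • v) - G p)))
  rw [abs_neg, abs_mul, abs_mul] at h4
  have h5 := mul_le_mul_of_nonneg_left h1 (abs_nonneg a)
  have h6 := mul_le_mul_of_nonneg_left h2 (abs_nonneg b)
  linarith

/-- Distances to the frontier and to an interior point almost never agree. -/
lemma volume_signedDist_eq_dist {X : Set (Space n)} (hX : (frontier X).Nonempty)
    (hX0 : volume (frontier X) = 0) {q : Space n} (hq : q ∈ interior X) :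
    volume {p | signedDist X p = dist p q} = 0 := by
  set g : Space n → ℝ := fun p => 1 * signedDist X p + 1 * (-dist p q) + 0 with hgdef
  have hg := lipschitzWith_linear_comb (abs_signedDist_sub_le X) (isEikonal_neg_dist q).abs_sub_le 1 1 0
  have hsub : {p | signedDist X p = dist p q} ⊆
      frontier X ∪ {p | g p = 0 ∧ p ∉ frontier X} := by
    intro p hp
    by_cases h : p ∈ frontier X
    · exact Or.inl h
    · have hp' : signedDist X p = dist p q := hp
      refine Or.inr ⟨?_, h⟩
      simp [hgdef, hp']
  refine measure_mono_null hsub (measure_union_null hX0 ?_)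
  refine volume_zeros_eq_zero hg (fun p hp => hp.1) ?_
  rintro p ⟨hp, hpX⟩
  have hpq : signedDist X p = dist p q := by simp only [hgdef] at hp; linarith
  obtain ⟨z, hz, hzd⟩ := isClosed_frontier.exists_infDist_eq_dist hX p
  have hs : dist p z = dist p q := by
    rw [← hzd, ← abs_signedDist, hpq, abs_of_nonneg dist_nonneg]
  have hne : p ≠ z := by rintro rfl; exact hpX hz
  have hzq : z ≠ q := by rintro rfl; exact hz.2 hq
  obtain ⟨v, hv, hzv⟩ := exists_unit_toward hne
  set s := dist p z with hsdef
  have hspos : 0 < s := dist_pos.2 hne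
  -- Towards `z` the distance to the frontier falls at rate `1` and the distance to `q` has
  -- derivative `⟪p - q, v⟫ / s`. The rates agree only if `κ = 0`, which is excluded by `‖z - q‖² =
  -- 2 s κ` and `z ≠ q`.
  set κ : ℝ := s + inner ℝ (p - q) v with hκdef
  have hnorm : ‖p - q‖ = s := by rw [← dist_eq_norm, hs]
  have hκ : 0 < κ := by
    have h1 : 0 < ‖z - q‖ ^ 2 := by
      have : 0 < ‖z - q‖ := norm_pos_iff.2 (sub_ne_zero.2 hzq)
      positivity
    have h2 : z - q = (p - q) + s • v := by rw [hzv]; abel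
    rw [h2, norm_add_sq_real, norm_smul, hv, inner_smul_right, hnorm, Real.norm_of_nonneg hspos.le] at h1
    have h3 : 0 < 2 * s * κ := by rw [hκdef]; nlinarith
    by_contra h
    push Not at h
    nlinarith
  -- With `d` the new distance to `q`, `d² - (s - δ)² = 2 δ κ` and `d + (s - δ) ≤ 2 s`; dividing
  -- gives the rate `κ / s`.
  refine ⟨v, κ / s, by positivity, ?_⟩
  filter_upwards [Ioo_mem_nhdsGT hspos] with δ hδ
  have h1 : signedDist X (p + δ • v) ≤ s - δ := by
    refine (le_abs_self _).trans ?_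
    rw [abs_signedDist]
    refine (Metric.infDist_le_dist_of_mem hz).trans_eq ?_
    conv_lhs => rw [hzv]
    exact dist_add_smul_unit hv hδ.2.le
  have h2 : dist (p + δ • v) q ^ 2 = (s - δ) ^ 2 + 2 * δ * κ := by
    rw [dist_eq_norm, show p + δ • v - q = (p - q) + δ • v by abel, norm_add_sq_real, norm_smul, hv,
      inner_smul_right, hnorm, Real.norm_of_nonneg hδ.1.le, hκdef]
    ring
  have h3 : dist (p + δ • v) q ≤ s + δ := by
    calc dist (p + δ • v) q ≤ dist (p + δ • v) p + dist p q := dist_triangle _ _ _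
      _ = s + δ := by
        rw [dist_eq_norm, add_sub_cancel_left, norm_smul, hv, mul_one,
          Real.norm_of_nonneg hδ.1.le, ← hs, add_comm]
  have h4 : κ / s * δ ≤ dist (p + δ • v) q - (s - δ) := by
    set d := dist (p + δ • v) q
    have hd0 : 0 ≤ d := dist_nonneg
    have hκδ : 0 < δ * κ := mul_pos hδ.1 hκ
    have hge : 0 ≤ d - (s - δ) := by
      by_contra h
      push Not at h
      have := hδ.2
      nlinarith
    have h5 : 2 * δ * κ ≤ (d - (s - δ)) * (2 * s) := by
      have : 2 * δ * κ = (d - (s - δ)) * (d + (s - δ)) := by linear_combination -h2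
      rw [this]
      exact mul_le_mul_of_nonneg_left (by linarith) hge
    rw [div_mul_eq_mul_div, div_le_iff₀ hspos]
    linarith
  refine le_trans ?_ (neg_le_abs _)
  change _ ≤ -(1 * signedDist X (p + δ • v) + 1 * (-dist (p + δ • v) q) + 0)
  linarith

/-! ### Regular compact Jordan measurable sets -/

lemma isClosed_ci (S : Set (Space n)) : IsClosed (ci S) := isClosed_closure

lemma ci_mono {S T : Set (Space n)} (h : S ⊆ T) : ci S ⊆ ci T := closure_mono (interior_mono h)

lemma ci_subset_closure (S : Set (Space n)) : ci S ⊆ closure S := closure_mono interior_subset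

lemma interior_subset_interior_ci (S : Set (Space n)) : interior S ⊆ interior (ci S) :=
  interior_maximal subset_closure isOpen_interior

lemma ci_ci (S : Set (Space n)) : ci (ci S) = ci S := by
  refine Subset.antisymm ?_ (closure_mono (interior_subset_interior_ci S))
  exact closure_minimal interior_subset isClosed_closure

lemma frontier_ci_subset (S : Set (Space n)) : frontier (ci S) ⊆ frontier S := by
  rintro p ⟨hp1, hp2⟩
  rw [(isClosed_ci S).closure_eq] at hp1
  exact ⟨ci_subset_closure S hp1, fun h => hp2 (interior_subset_interior_ci S h)⟩

lemma isRegularCompactJordan_ci {S : Set (Space n)} (hb : Bornology.IsBounded S)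
    (h0 : volume (frontier S) = 0) : IsRegularCompactJordan (ci S) :=
  ⟨hb.closure.subset (ci_subset_closure S), (ci_ci S).symm,
    measure_mono_null (frontier_ci_subset S) h0⟩

lemma ci_ae_eq {S : Set (Space n)} (h0 : volume (frontier S) = 0) : ci S =ᵐ[volume] S := by
  have h1 : volume (frontier (interior S)) = 0 :=
    measure_mono_null frontier_interior_subset h0
  exact (closure_ae_eq_of_null_frontier h1).trans (interior_ae_eq_of_null_frontier h0)

/-- `O \ T` is open and null, hence empty. This is how almost everywhere inclusions become genuine
ones. -/
lemma subset_of_isOpen_of_ae_le {O T : Set (Space n)} (hO : IsOpen O) (hT : IsClosed T)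
    (h : O ≤ᵐ[volume] T) : O ⊆ T := by
  rw [← sdiff_eq_empty, ← (hO.sdiff hT).measure_eq_zero_iff volume]
  exact ae_le_set.1 h

lemma ci_subset_of_ae_le {S T : Set (Space n)} (hT : IsClosed T) (h : S ≤ᵐ[volume] T) :
    ci S ⊆ T :=
  closure_minimal (subset_of_isOpen_of_ae_le isOpen_interior hT
    ((LE.le.eventuallyLE interior_subset).trans h)) hT

lemma ci_subset_ci_of_ae_le {S T : Set (Space n)} (h : S ≤ᵐ[volume] T)
    (hT : volume (frontier T) = 0) : ci S ⊆ ci T :=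
  ci_subset_of_ae_le (isClosed_ci T) (h.trans (ci_ae_eq hT).symm.le)

/-- The interior of `T` lies in the closed set `S`, so `S` can have frontier only on `∂T` or on the
null set `S \ T`. -/
lemma volume_frontier_eq_zero_of_ae_eq {S T : Set (Space n)} (hS : IsClosed S)
    (h : S =ᵐ[volume] T) (hT : volume (frontier T) = 0) : volume (frontier S) = 0 := by
  have h1 : interior T ⊆ interior S := by
    refine interior_maximal (subset_of_isOpen_of_ae_le isOpen_interior hS ?_) isOpen_interior
    exact (LE.le.eventuallyLE interior_subset).trans h.symm.le
  have h2 : frontier S ⊆ (S \ T) ∪ frontier T := by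
    rintro p ⟨hp1, hp2⟩
    rw [hS.closure_eq] at hp1
    by_cases hpT : p ∈ T
    · exact Or.inr ⟨subset_closure hpT, fun h' => hp2 (h1 h')⟩
    · exact Or.inl ⟨hp1, hpT⟩
  exact measure_mono_null h2 (measure_union_null (ae_le_set.1 h.le) hT)

namespace IsRegularCompactJordan

variable {A B : Set (Space n)}

lemma isClosed (hA : IsRegularCompactJordan A) : IsClosed A := by
  rw [hA.eq_ci]; exact isClosed_ci A

lemma measurableSet (hA : IsRegularCompactJordan A) : MeasurableSet A := hA.isClosed.measurableSet

lemma volume_ne_top (hA : IsRegularCompactJordan A) : volume A ≠ ⊤ :=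
  hA.isBounded.measure_lt_top.ne

lemma subset_of_ae_le (hA : IsRegularCompactJordan A) (hB : IsClosed B)
    (h : A ≤ᵐ[volume] B) : A ⊆ B := by
  rw [hA.eq_ci]; exact ci_subset_of_ae_le hB h

lemma union (hA : IsRegularCompactJordan A) (hB : IsRegularCompactJordan B) :
    IsRegularCompactJordan (A ∪ B) := by
  refine ⟨hA.isBounded.union hB.isBounded, Subset.antisymm ?_ ?_, ?_⟩
  · refine union_subset ?_ ?_
    · exact hA.eq_ci.subset.trans (ci_mono subset_union_left)
    · exact hB.eq_ci.subset.trans (ci_mono subset_union_right)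
  · exact (ci_subset_closure _).trans (hA.isClosed.union hB.isClosed).closure_eq.subset
  · refine measure_mono_null ?_ (measure_union_null hA.volume_frontier hB.volume_frontier)
    exact (frontier_union_subset A B).trans (union_subset_union inter_subset_left inter_subset_right)

lemma empty : IsRegularCompactJordan (∅ : Set (Space n)) :=
  ⟨Bornology.isBounded_empty, by simp [ci], by simp⟩

lemma biUnion {ι : Type*} {s : Set ι} (hs : s.Finite) {f : ι → Set (Space n)}
    (hf : ∀ i ∈ s, IsRegularCompactJordan (f i)) : IsRegularCompactJordan (⋃ i ∈ s, f i) := by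
  induction s, hs using Set.Finite.induction_on with
  | empty => simpa using empty
  | @insert a s _ _ ih =>
    rw [biUnion_insert]
    exact (hf a (mem_insert a s)).union (ih fun i hi => hf i (mem_insert_of_mem a hi))

end IsRegularCompactJordan

lemma volume_frontier_inter_eq_zero {A B : Set (Space n)} (hA : volume (frontier A) = 0)
    (hB : volume (frontier B) = 0) : volume (frontier (A ∩ B)) = 0 :=
  measure_mono_null ((frontier_inter_subset A B).trans
    (union_subset_union inter_subset_left inter_subset_right)) (measure_union_null hA hB)

lemma volume_frontier_biInter_eq_zero {ι : Type*} {s : Set ι} (hs : s.Finite)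
    {f : ι → Set (Space n)} (hf : ∀ i ∈ s, volume (frontier (f i)) = 0) :
    volume (frontier (⋂ i ∈ s, f i)) = 0 := by
  induction s, hs using Set.Finite.induction_on with
  | empty => simp
  | @insert a s _ _ ih =>
    rw [biInter_insert]
    exact volume_frontier_inter_eq_zero (hf a (mem_insert a s))
      (ih fun i hi => hf i (mem_insert_of_mem a hi))

lemma ae_le_of_subset_of_measureReal_le {S T : Set (Space n)} (h : S ⊆ T)
    (hS : NullMeasurableSet S) (hT : volume T ≠ ⊤) (hle : volume.real T ≤ volume.real S) :
    T ≤ᵐ[volume] S := by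
  refine (ae_eq_of_subset_of_measure_ge h ?_ hS hT).symm.le
  exact (ENNReal.toReal_le_toReal hT (ne_top_of_le_ne_top hT (measure_mono h))).1 hle

/-! ### One-parameter families of averages -/

/-- The relation `P` determines a single set for each parameter, and these sets form an increasing
family of regular compact Jordan measurable sets from `B` to `A`, whose measure grows at most at the
rate at which the measures of `B` and `A` are interpolated. -/
structure IsAvgFamily (P : ℝ → Set (Space n) → Prop) (A B : Set (Space n))
    (R : ℝ → Set (Space n)) : Prop where
  iff : ∀ t S, P t S ↔ S = R t
  regular : ∀ t, IsRegularCompactJordan (R t)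
  mono : Monotone R
  zero : R 0 = B
  one : R 1 = A
  measure_diff_le : ∀ s t, s ≤ t →
    volume.real (R t \ R s) ≤ (t - s) * (volume.real A - volume.real B)

lemma measureReal_sdiff_of_isRegularCompactJordan {S T : Set (Space n)} (h : S ⊆ T)
    (hS : IsRegularCompactJordan S) (hT : IsRegularCompactJordan T) :
    volume.real (T \ S) = volume.real T - volume.real S :=
  measureReal_sdiff h hS.measurableSet hT.volume_ne_top

/-- The growth bounds on `[0, t]` and `[t, 1]` sum to the exact total increase, so neither can be
strict. -/
lemma IsAvgFamily.measure_eq {P : ℝ → Set (Space n) → Prop} {A B : Set (Space n)}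
    {R : ℝ → Set (Space n)} (h : IsAvgFamily P A B R) {t : ℝ} (ht : t ∈ Icc (0 : ℝ) 1) :
    volume.real (R t) = t * volume.real A + (1 - t) * volume.real B := by
  have h1 := h.measure_diff_le 0 t ht.1
  have h2 := h.measure_diff_le t 1 ht.2
  rw [measureReal_sdiff_of_isRegularCompactJordan (h.mono ht.1) (h.regular _) (h.regular _),
    h.zero] at h1
  rw [measureReal_sdiff_of_isRegularCompactJordan (h.mono ht.2) (h.regular _) (h.regular _),
    h.one] at h2
  linarith

/-! ### The distance average of nested sets -/

/-- The hypotheses under which two nested sets have a well-behaved simple average. -/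
structure IsSimplePair (c : Set (Space n) → Space n) (E B : Set (Space n)) : Prop where
  subset : B ⊆ E
  regular : IsRegularCompactJordan B
  isBounded : Bornology.IsBounded E
  volume_frontier : volume (frontier E) = 0
  interior_nonempty : (interior E).Nonempty
  isCenterChoice : IsCenterChoice c

/-- `E` need not be closed: the maximum over its compact closure is positive because `E` has
interior, so it is attained at an interior point. -/
lemma exists_isCenter {E : Set (Space n)} (hE : (interior E).Nonempty)
    (hb : Bornology.IsBounded E) (hf : (frontier E).Nonempty) : ∃ q, IsCenter E q := by
  have hcomp : IsCompact (closure E) := Metric.isCompact_of_isClosed_isBounded isClosed_closure hb.closure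
  obtain ⟨a, ha⟩ := hE
  obtain ⟨q, hq, hmax⟩ := hcomp.exists_isMaxOn ⟨a, subset_closure (interior_subset ha)⟩
    (isEikonal_signedDist hf).continuous.continuousOn
  have hpos : 0 < signedDist E q :=
    ((signedDist_pos_iff hf).2 ha).trans_le (hmax (subset_closure (interior_subset ha)))
  exact ⟨q, interior_subset ((signedDist_pos_iff hf).1 hpos), fun b hb => hmax (subset_closure hb)⟩

lemma isCenter_mem_interior {E : Set (Space n)} (hE : (interior E).Nonempty)
    (hf : (frontier E).Nonempty) {q : Space n} (hq : IsCenter E q) : q ∈ interior E := by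
  obtain ⟨a, ha⟩ := hE
  exact (signedDist_pos_iff hf).1
    (((signedDist_pos_iff hf).2 ha).trans_le (hq.2 a (interior_subset ha)))

/-- Off the null set `{f x₀ = 0}` the sign of `f x p` is constant for `x` near `x₀`, so the
indicators converge almost everywhere inside a set of finite measure. -/
lemma continuousAt_measureReal_superlevel {f : ℝ → Space n → ℝ} {x₀ : ℝ}
    (hf : ∀ p, Continuous fun x => f x p) (hfm : ∀ x, Continuous (f x))
    (h0 : volume {p | f x₀ p = 0} = 0) {K : Set (Space n)} (hK : volume K ≠ ⊤) :
    ContinuousAt (fun x => volume.real ({p | 0 ≤ f x p} ∩ K)) x₀ := by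
  have hm : ∀ x, MeasurableSet {p | 0 ≤ f x p} := fun x =>
    (isClosed_le continuous_const (hfm x)).measurableSet
  have key : Tendsto (fun x => (volume.restrict K) {p | 0 ≤ f x p}) (𝓝 x₀)
      (𝓝 ((volume.restrict K) {p | 0 ≤ f x₀ p})) := by
    refine tendsto_measure_of_ae_tendsto_indicator (𝓝 x₀) (hm x₀) hm MeasurableSet.univ
      (by simpa using hK) (Eventually.of_forall fun _ => subset_univ _) ?_
    refine ae_restrict_of_ae ?_
    have hne : ∀ᵐ p ∂(volume : Measure (Space n)), f x₀ p ≠ 0 := by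
      rw [ae_iff]; simpa using h0
    filter_upwards [hne] with p hp
    rcases lt_or_gt_of_ne hp with h | h
    · filter_upwards [(hf p).continuousAt.eventually_lt continuousAt_const h] with x hx
      exact ⟨fun h' => absurd h' (not_le.2 hx), fun h' => absurd h' (not_le.2 h)⟩
    · filter_upwards [continuousAt_const.eventually_lt (hf p).continuousAt h] with x hx
      exact ⟨fun _ => h.le, fun _ => hx.le⟩
  simp only [Measure.restrict_apply (hm _)] at key
  refine (ENNReal.tendsto_toReal ?_).comp key
  exact ne_top_of_le_ne_top hK (measure_mono inter_subset_right)

/-! ### Monotonicity, null level sets and boundedness of distance averages -/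

namespace IsSimplePair

variable {c : Set (Space n) → Space n} {E B : Set (Space n)}

lemma nonempty (h : IsSimplePair c E B) : E.Nonempty := h.interior_nonempty.mono interior_subset

lemma relDist_left (h : IsSimplePair c E B) : relDist c E B = signedDist E := by
  ext p; simp [relDist, h.nonempty.ne_empty]

lemma distAvg_eq (h : IsSimplePair c E B) (x : ℝ) :
    distAvg c x E B = {p | 0 ≤ avgFun c x E B p} := by
  simp [distAvg, h.nonempty.ne_empty]

lemma avgFun_eq (h : IsSimplePair c E B) (x : ℝ) (p : Space n) :
    avgFun c x E B p = x * signedDist E p + (1 - x) * relDist c B E p := by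
  rw [avgFun, h.relDist_left]

lemma continuous_avgFun_param (p : Space n) : Continuous fun x => avgFun c x E B p := by
  unfold avgFun; fun_prop

lemma volume_ne_top (h : IsSimplePair c E B) : volume E ≠ ⊤ := h.isBounded.measure_lt_top.ne

lemma nullMeasurableSet (h : IsSimplePair c E B) : NullMeasurableSet E :=
  nullMeasurableSet_of_null_frontier h.volume_frontier

variable [NeZero n]

lemma frontier_left (h : IsSimplePair c E B) : (frontier E).Nonempty :=
  frontier_nonempty_of_isBounded h.nonempty h.isBounded

lemma frontier_right (h : IsSimplePair c E B) (hB : B ≠ ∅) : (frontier B).Nonempty :=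
  frontier_nonempty_of_isBounded (nonempty_iff_ne_empty.2 hB) h.regular.isBounded

lemma isCenter (h : IsSimplePair c E B) : IsCenter E (c E) :=
  h.isCenterChoice E (exists_isCenter h.interior_nonempty h.isBounded h.frontier_left)

lemma isEikonal_relDist (h : IsSimplePair c E B) : IsEikonal (relDist c B E) := by
  by_cases hB : B = ∅
  · have : relDist c B E = fun p => -dist p (c E) := by ext p; simp [relDist, hB]
    rw [this]; exact isEikonal_neg_dist _
  · have : relDist c B E = signedDist B := by ext p; simp [relDist, hB]
    rw [this]; exact isEikonal_signedDist (h.frontier_right hB)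

lemma volume_relDist_eq_zero (h : IsSimplePair c E B) :
    volume {p | relDist c B E p = 0} = 0 := by
  by_cases hB : B = ∅
  · have : {p | relDist c B E p = 0} = {c E} := by ext p; simp [relDist, hB]
    rw [this]; exact measure_singleton _
  · have : {p | relDist c B E p = 0} = frontier B := by
      ext p
      simp only [relDist, hB, if_false]
      exact signedDist_eq_zero_iff (h.frontier_right hB)
    rw [this]; exact h.regular.volume_frontier

/-- For `B = ∅` this is the Lipschitz bound between `p` and the centre, where the signed distance to
`E` is nonnegative. -/
lemma relDist_le (h : IsSimplePair c E B) (p : Space n) : relDist c B E p ≤ signedDist E p := by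
  by_cases hB : B = ∅
  · simp only [relDist, hB, if_true]
    have h1 := (abs_le.1 (abs_signedDist_sub_le E p (c E))).1
    have h2 : 0 ≤ signedDist E (c E) :=
      (signedDist_nonneg_iff h.frontier_left).2 (subset_closure h.isCenter.1)
    linarith
  · simp only [relDist, hB, if_false]
    exact signedDist_mono h.subset (h.frontier_right hB) h.frontier_left p

lemma volume_signedDist_eq_zero (h : IsSimplePair c E B) :
    volume {p | signedDist E p = 0} = 0 := by
  have : {p | signedDist E p = 0} = frontier E := by
    ext p; exact signedDist_eq_zero_iff h.frontier_left
  rw [this]; exact h.volume_frontier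

lemma continuous_avgFun (h : IsSimplePair c E B) (x : ℝ) : Continuous (avgFun c x E B) := by
  have : avgFun c x E B = fun p => x * signedDist E p + (1 - x) * relDist c B E p :=
    funext (h.avgFun_eq x)
  rw [this]
  have h1 := (isEikonal_signedDist h.frontier_left).continuous
  have h2 := h.isEikonal_relDist.continuous
  fun_prop

lemma isClosed_distAvg (h : IsSimplePair c E B) (x : ℝ) : IsClosed (distAvg c x E B) := by
  rw [h.distAvg_eq]; exact isClosed_le continuous_const (h.continuous_avgFun x)

/-- `|x| = |1 - x|` forces `x = 1 / 2`; otherwise one of the two weights dominates. -/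
lemma volume_avgFun_eq_zero (h : IsSimplePair c E B) {x : ℝ} (hx : x ≠ 1 / 2) :
    volume {p | avgFun c x E B p = 0} = 0 := by
  have hF := isEikonal_signedDist h.frontier_left
  have hG := h.isEikonal_relDist
  rcases lt_or_gt_of_ne (a := |x|) (b := |1 - x|) (by
    intro he
    rcases abs_eq_abs.1 he with h1 | h1
    · exact hx (by linarith)
    · linarith) with hlt | hlt
  · have := volume_linear_comb_eq_zero hG h.volume_relDist_eq_zero hF.abs_sub_le hlt 0
    refine measure_mono_null (fun p hp => ?_) this
    have hp' : avgFun c x E B p = 0 := hp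
    rw [h.avgFun_eq] at hp'
    change (1 - x) * relDist c B E p + x * signedDist E p + 0 = 0
    linarith
  · have := volume_linear_comb_eq_zero hF h.volume_signedDist_eq_zero hG.abs_sub_le hlt 0
    refine measure_mono_null (fun p hp => ?_) this
    have hp' : avgFun c x E B p = 0 := hp
    rw [h.avgFun_eq] at hp'
    change x * signedDist E p + (1 - x) * relDist c B E p + 0 = 0
    linarith

/-- Consequently neighbourhoods of `B` are only ever used for nonempty `B`. -/
lemma zeroMeasureCondition_of_eq_empty (h : IsSimplePair c E B) (hB : B = ∅) :
    ZeroMeasureCondition c E B := by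
  refine measure_mono_null (fun p hp => ?_) (volume_signedDist_eq_dist h.frontier_left
    h.volume_frontier (isCenter_mem_interior h.interior_nonempty h.frontier_left h.isCenter))
  have hp' : avgFun c (1 / 2) E B p = 0 := hp
  rw [h.avgFun_eq] at hp'
  simp only [relDist, hB, if_true] at hp'
  change signedDist E p = dist p (c E)
  linarith

lemma distAvg_mono (h : IsSimplePair c E B) : Monotone fun x => distAvg c x E B := by
  intro x y hxy p hp
  simp only [h.distAvg_eq] at hp ⊢
  have hp' : 0 ≤ avgFun c x E B p := hp
  change 0 ≤ avgFun c y E B p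
  rw [h.avgFun_eq] at hp' ⊢
  nlinarith [h.relDist_le p]

lemma exists_neg_dist_le_relDist (h : IsSimplePair c E B) :
    ∃ b, ∀ p, -dist p b ≤ relDist c B E p := by
  by_cases hB : B = ∅
  · exact ⟨c E, fun p => by simp [relDist, hB]⟩
  · obtain ⟨b, hb⟩ := h.frontier_right hB
    refine ⟨b, fun p => ?_⟩
    simp only [relDist, hB, if_false]
    have h1 := (abs_le.1 (abs_signedDist_sub_le B p b)).1
    rw [(signedDist_eq_zero_iff ⟨b, hb⟩).2 hb] at h1
    linarith

lemma isBounded_distAvg (h : IsSimplePair c E B) (x : ℝ) :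
    Bornology.IsBounded (distAvg c x E B) := by
  wlog hx : 1 ≤ x generalizing x
  · exact (this 1 le_rfl).subset (h.distAvg_mono (by linarith : x ≤ 1))
  obtain ⟨b, hb⟩ := h.exists_neg_dist_le_relDist
  obtain ⟨R, hR⟩ := h.isBounded.closure.subset_closedBall b
  -- Outside `E`, with nearest frontier point `z`, nonnegativity gives `x d(p,z) ≤ (x-1) d(p,b)`.
  -- Combined with `d(p,b) ≤ d(p,z) + R` this yields `d(p,b) ≤ x R`.
  refine Metric.isBounded_closedBall.subset (fun p hp => ?_ : _ ⊆ Metric.closedBall b (x * R))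
  rw [h.distAvg_eq] at hp
  have hp' : 0 ≤ avgFun c x E B p := hp
  rw [h.avgFun_eq] at hp'
  obtain ⟨z, hz, hzd⟩ := isClosed_frontier.exists_infDist_eq_dist h.frontier_left p
  have hzR : dist z b ≤ R := hR hz.1
  have hR0 : 0 ≤ R := dist_nonneg.trans hzR
  rw [Metric.mem_closedBall]
  by_cases hpE : p ∈ E
  · have : dist p b ≤ R := hR (subset_closure hpE)
    nlinarith
  · have h1 : signedDist E p = -dist p z := by simp [signedDist, hpE, hzd]
    have h2 := hb p
    have h3 := dist_triangle p z b
    rw [h1] at hp'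
    nlinarith

lemma volume_distAvg_ne_top (h : IsSimplePair c E B) (x : ℝ) : volume (distAvg c x E B) ≠ ⊤ :=
  (h.isBounded_distAvg x).measure_lt_top.ne

lemma measureReal_distAvg_mono (h : IsSimplePair c E B) :
    Monotone fun x => volume.real (distAvg c x E B) := fun _ y hxy =>
  measureReal_mono (h.distAvg_mono hxy) (h.volume_distAvg_ne_top y)

/-- Nestedness makes the order of the measures decide inclusion, even when `x > y`. -/
lemma distAvg_ae_le (h : IsSimplePair c E B) {x y : ℝ}
    (hle : volume.real (distAvg c x E B) ≤ volume.real (distAvg c y E B)) :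
    distAvg c x E B ≤ᵐ[volume] distAvg c y E B := by
  rcases le_total x y with hxy | hxy
  · exact LE.le.eventuallyLE (h.distAvg_mono hxy)
  · exact ae_le_of_subset_of_measureReal_le (h.distAvg_mono hxy)
      (h.isClosed_distAvg y).measurableSet.nullMeasurableSet (h.volume_distAvg_ne_top x) hle

lemma continuousAt_measureReal_distAvg (h : IsSimplePair c E B) {x : ℝ}
    (hx : volume {p | avgFun c x E B p = 0} = 0) :
    ContinuousAt (fun x => volume.real (distAvg c x E B)) x := by
  -- The distance average at `x + 1` is a finite-measure window containing all averages with nearby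
  -- parameters.
  have := continuousAt_measureReal_superlevel (f := fun x => avgFun c x E B)
    (fun p => continuous_avgFun_param p) h.continuous_avgFun hx (h.volume_distAvg_ne_top (x + 1))
  refine this.congr ?_
  filter_upwards [Iio_mem_nhds (lt_add_one x)] with y hy
  rw [← h.distAvg_eq, inter_eq_self_of_subset_left (h.distAvg_mono (le_of_lt hy))]

lemma volume_frontier_distAvg (h : IsSimplePair c E B) {x : ℝ}
    (hx : volume {p | avgFun c x E B p = 0} = 0) : volume (frontier (distAvg c x E B)) = 0 := by
  refine measure_mono_null ?_ hx
  rw [h.distAvg_eq]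
  exact (frontier_le_subset_eq continuous_const (h.continuous_avgFun x)).trans
    fun p hp => (Eq.symm hp : _)

lemma distAvg_one (h : IsSimplePair c E B) : distAvg c 1 E B = closure E := by
  rw [h.distAvg_eq]
  ext p
  rw [← signedDist_nonneg_iff h.frontier_left]
  change 0 ≤ avgFun c 1 E B p ↔ _
  rw [h.avgFun_eq]
  simp

lemma distAvg_one_ae_eq (h : IsSimplePair c E B) : distAvg c 1 E B =ᵐ[volume] E := by
  rw [h.distAvg_one]; exact closure_ae_eq_of_null_frontier h.volume_frontier

/-- Equality can fail on a null set: for `B = ∅` the left side is the single point `c E`. -/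
lemma distAvg_zero_ae_eq (h : IsSimplePair c E B) : distAvg c 0 E B =ᵐ[volume] B := by
  rw [h.distAvg_eq]
  simp only [h.avgFun_eq, zero_mul, zero_add, sub_zero, one_mul]
  by_cases hB : B = ∅
  · have : {p | 0 ≤ relDist c B E p} ⊆ {p | relDist c B E p = 0} := by
      intro p hp
      have hp' : 0 ≤ relDist c B E p := hp
      refine le_antisymm ?_ hp'
      simp [relDist, hB]
    rw [ae_eq_set]
    exact ⟨measure_mono_null (sdiff_subset.trans this) h.volume_relDist_eq_zero, by simp [hB]⟩
  · have : {p | 0 ≤ relDist c B E p} = B := by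
      ext p
      simp only [relDist, hB, if_false]
      refine (signedDist_nonneg_iff (h.frontier_right hB)).trans ?_
      rw [h.regular.isClosed.closure_eq]
    exact Eq.eventuallyEq this

end IsSimplePair

/-! ### Simple averages -/

/-- `τ` clamped to the interval from `lo` to `hi`. -/
def clamp (lo hi τ : ℝ) : ℝ := max lo (min τ hi)

lemma clamp_eq_self {lo hi τ : ℝ} (h1 : lo ≤ τ) (h2 : τ ≤ hi) : clamp lo hi τ = τ := by
  rw [clamp, min_eq_left h2, max_eq_right h1]

lemma clamp_sub_le {lo hi τ σ : ℝ} (h : σ ≤ τ) :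
    clamp lo hi τ - clamp lo hi σ ≤ τ - σ := by
  have h1 : min τ hi ≤ min σ hi + (τ - σ) := by
    rw [← min_add_add_right]
    exact min_le_min (by linarith) (by linarith)
  have h2 : clamp lo hi τ ≤ clamp lo hi σ + (τ - σ) := by
    refine max_le ?_ (h1.trans ?_)
    · have : lo ≤ clamp lo hi σ := le_max_left _ _
      linarith
    · have : min σ hi ≤ clamp lo hi σ := le_max_right _ _
      linarith
  linarith

lemma clamp_mono (lo hi : ℝ) : Monotone (clamp lo hi) := fun _ _ h =>
  max_le_max le_rfl (min_le_min h le_rfl)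

lemma clamp_mem {lo hi : ℝ} (h : lo ≤ hi) (τ : ℝ) : clamp lo hi τ ∈ Icc lo hi :=
  ⟨le_max_left _ _, max_le h (min_le_right _ _)⟩

lemma abs_clamp_sub_le {lo hi τ v : ℝ} (hv : v ∈ Icc lo hi) :
    |clamp lo hi τ - τ| ≤ |v - τ| := by
  rcases le_total τ lo with h | h
  · have : clamp lo hi τ = lo := max_eq_left ((min_le_left _ _).trans h)
    rw [this, abs_of_nonneg (by linarith), abs_of_nonneg (by linarith [hv.1])]
    linarith [hv.1]
  · rcases le_total τ hi with h' | h'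
    · rw [clamp_eq_self h h', sub_self, abs_zero]; exact abs_nonneg _
    · have : clamp lo hi τ = hi := by
        rw [clamp, min_eq_right h', max_eq_right (hv.1.trans hv.2)]
      rw [this, abs_of_nonpos (by linarith), abs_of_nonpos (by linarith [hv.2])]
      linarith [hv.2]

/-- The nearest point of an interval is unique. -/
lemma eq_clamp_of_abs_le {lo hi τ v : ℝ} (hv : v ∈ Icc lo hi)
    (h : |v - τ| ≤ |clamp lo hi τ - τ|) : v = clamp lo hi τ := by
  rcases le_total τ lo with h1 | h1
  · have : clamp lo hi τ = lo := max_eq_left ((min_le_left _ _).trans h1)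
    rw [this] at h ⊢
    rw [abs_of_nonneg (by linarith [hv.1]), abs_of_nonneg (by linarith)] at h
    linarith [hv.1]
  · rcases le_total τ hi with h' | h'
    · rw [clamp_eq_self h1 h', sub_self, abs_zero] at h
      rw [clamp_eq_self h1 h']
      linarith [abs_nonpos_iff.1 h]
    · have : clamp lo hi τ = hi := by
        rw [clamp, min_eq_right h', max_eq_right (hv.1.trans hv.2)]
      rw [this] at h ⊢
      rw [abs_of_nonpos (by linarith [hv.2]), abs_of_nonpos (by linarith)] at h
      linarith [hv.2]

/-- The measure prescribed for the simple average with weights `t` and `1 - t`. -/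
def targetMeasure (t : ℝ) (E B : Set (Space n)) : ℝ := t * volume.real E + (1 - t) * volume.real B

/-- The measure of the simple average with weights `t` and `1 - t`. -/
def simpleMeasure (c : Set (Space n) → Space n) (N t : ℝ) (E B : Set (Space n)) : ℝ :=
  clamp (volume.real (distAvg c (-N) E B)) (volume.real (distAvg c N E B)) (targetMeasure t E B)

/-- `W` is one of the sets whose regularization is the simple average. -/
def IsPreAvg (c : Set (Space n) → Space n) (N t : ℝ) (E B W : Set (Space n)) : Prop :=
  ((ZeroMeasureCondition c E B ∨ t ∉ Icc (0 : ℝ) 1) ∧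
    ∃ x, IsReparam c N t E B x ∧ W = distAvg c x E B) ∨
  ((¬ ZeroMeasureCondition c E B ∧ t ∈ Icc (0 : ℝ) 1) ∧
    ∃ r, 0 ≤ r ∧ volume.real (Metric.cthickening r B ∩ E) = targetMeasure t E B ∧
      W = Metric.cthickening r B ∩ E)

lemma isSimpleAvg_iff {c : Set (Space n) → Space n} {N t : ℝ} {E B S : Set (Space n)} :
    IsSimpleAvg c N t E B S ↔ ∃ W, IsPreAvg c N t E B W ∧ S = ci W := by
  constructor
  · rintro (⟨h1, x, hx, rfl⟩ | ⟨h1, r, hr, hm, rfl⟩)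
    · exact ⟨_, Or.inl ⟨h1, x, hx, rfl⟩, rfl⟩
    · exact ⟨_, Or.inr ⟨h1, r, hr, hm, rfl⟩, rfl⟩
  · rintro ⟨W, (⟨h1, x, hx, rfl⟩ | ⟨h1, r, hr, hm, rfl⟩), rfl⟩
    · exact Or.inl ⟨h1, x, hx, rfl⟩
    · exact Or.inr ⟨h1, r, hr, hm, rfl⟩

/-- Outside a closed set the distances to the set and to its frontier coincide. Neighbourhoods thus
become superlevel sets, to which the null level set and continuity results apply. -/
lemma cthickening_eq_signedDist {B : Set (Space n)} (hB : IsClosed B)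
    (hf : (frontier B).Nonempty) {r : ℝ} (hr : 0 ≤ r) :
    Metric.cthickening r B = {p | 0 ≤ r + signedDist B p} := by
  have hne : B.Nonempty := hf.mono hB.frontier_subset
  ext p
  rw [Metric.mem_cthickening_iff, ← ENNReal.ofReal_toReal (Metric.infEDist_ne_top hne),
    ENNReal.ofReal_le_ofReal_iff hr]
  change Metric.infDist p B ≤ r ↔ 0 ≤ r + signedDist B p
  by_cases hp : p ∈ B
  · simp only [signedDist, hp, if_true, Metric.infDist_zero_of_mem]
    have : 0 ≤ Metric.infDist p (frontier B) := Metric.infDist_nonneg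
    exact ⟨fun _ => by linarith, fun _ => hr⟩
  · have : Metric.infDist p B = Metric.infDist p (frontier B) := by
      refine le_antisymm (Metric.infDist_le_infDist_of_subset hB.frontier_subset hf) ?_
      obtain ⟨z, hz, hzd⟩ := hB.exists_infDist_eq_dist hne p
      rw [hzd, ← frontier_compl]
      refine infDist_frontier_le (X := Bᶜ) hp ?_
      rw [interior_compl]
      exact fun h => h (subset_closure hz)
    simp only [signedDist, hp, if_false, this]
    constructor <;> intro <;> linarith

/-! ### Existence, ordering and regularity of the sets behind a simple average -/

namespace IsSimplePair

variable {c : Set (Space n) → Space n} {E B : Set (Space n)} {N : ℝ}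

lemma measureReal_le (h : IsSimplePair c E B) : volume.real B ≤ volume.real E :=
  measureReal_mono h.subset h.volume_ne_top

lemma targetMeasure_mono (h : IsSimplePair c E B) : Monotone fun t => targetMeasure t E B := by
  intro s t hst
  have := h.measureReal_le
  simp only [targetMeasure]
  nlinarith

lemma volume_inter_ne_top (h : IsSimplePair c E B) (S : Set (Space n)) : volume (S ∩ E) ≠ ⊤ :=
  ne_top_of_le_ne_top h.volume_ne_top (measure_mono inter_subset_right)

lemma nullMeasurableSet_cthickening_inter (h : IsSimplePair c E B) (r : ℝ) :
    NullMeasurableSet (Metric.cthickening r B ∩ E) :=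
  Metric.isClosed_cthickening.measurableSet.nullMeasurableSet.inter h.nullMeasurableSet

lemma subset_cthickening_inter (h : IsSimplePair c E B) (r : ℝ) :
    B ⊆ Metric.cthickening r B ∩ E :=
  subset_inter (Metric.self_subset_cthickening B) h.subset

lemma cthickening_inter_ae_le (h : IsSimplePair c E B) {r s : ℝ}
    (hle : volume.real (Metric.cthickening r B ∩ E) ≤ volume.real (Metric.cthickening s B ∩ E)) :
    (Metric.cthickening r B ∩ E : Set (Space n)) ≤ᵐ[volume] (Metric.cthickening s B ∩ E : Set _) := by
  rcases le_total r s with hrs | hrs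
  · exact LE.le.eventuallyLE (inter_subset_inter_left E (Metric.cthickening_mono hrs B))
  · exact ae_le_of_subset_of_measureReal_le
      (inter_subset_inter_left E (Metric.cthickening_mono hrs B))
      (h.nullMeasurableSet_cthickening_inter s) (h.volume_inter_ne_top _) hle

lemma simpleMeasure_mono (h : IsSimplePair c E B) : Monotone fun t => simpleMeasure c N t E B :=
  fun _ _ hst => clamp_mono _ _ (h.targetMeasure_mono hst)

variable [NeZero n]

lemma measureReal_distAvg_zero (h : IsSimplePair c E B) :
    volume.real (distAvg c 0 E B) = volume.real B :=
  measureReal_congr h.distAvg_zero_ae_eq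

lemma measureReal_distAvg_one (h : IsSimplePair c E B) :
    volume.real (distAvg c 1 E B) = volume.real E :=
  measureReal_congr h.distAvg_one_ae_eq

/-- Since `h(0) = μ(B)`, `h(1) = μ(E)` and `[0, 1] ⊆ [-N, N]`, the clamp is inactive. -/
lemma simpleMeasure_eq (h : IsSimplePair c E B) (hN : 1 < N) {t : ℝ} (ht : t ∈ Icc (0 : ℝ) 1) :
    simpleMeasure c N t E B = targetMeasure t E B := by
  have h0 : volume.real B = targetMeasure 0 E B := by simp [targetMeasure]
  have h1 : volume.real E = targetMeasure 1 E B := by simp [targetMeasure]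
  refine clamp_eq_self ?_ ?_
  · refine le_trans ?_ (h.targetMeasure_mono ht.1)
    simp only
    rw [← h0, ← h.measureReal_distAvg_zero]
    exact h.measureReal_distAvg_mono (by linarith)
  · refine (h.targetMeasure_mono ht.2).trans ?_
    simp only
    rw [← h1, ← h.measureReal_distAvg_one]
    exact h.measureReal_distAvg_mono hN.le

lemma simpleMeasure_zero (h : IsSimplePair c E B) (hN : 1 < N) :
    simpleMeasure c N 0 E B = volume.real B := by
  rw [h.simpleMeasure_eq hN (by simp)]; simp [targetMeasure]

lemma simpleMeasure_one (h : IsSimplePair c E B) (hN : 1 < N) :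
    simpleMeasure c N 1 E B = volume.real E := by
  rw [h.simpleMeasure_eq hN (by simp)]; simp [targetMeasure]

/-- `h` can jump only at `1 / 2`. Without the zero-measure condition, the value sought is at most
`h(0)` or at least `h(1)`, so the intermediate value theorem runs on `[-N, 0]` or `[1, N]`. -/
lemma exists_distAvg_measure_eq (h : IsSimplePair c E B) (hN : 1 < N) {t : ℝ}
    (ht : ZeroMeasureCondition c E B ∨ t ∉ Icc (0 : ℝ) 1) :
    ∃ x ∈ Icc (-N) N, volume.real (distAvg c x E B) = simpleMeasure c N t E B := by
  have hmem : simpleMeasure c N t E B ∈ Icc (volume.real (distAvg c (-N) E B))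
      (volume.real (distAvg c N E B)) :=
    clamp_mem (h.measureReal_distAvg_mono (by linarith)) _
  have ivt : ∀ a b : ℝ, a ≤ b → -N ≤ a → b ≤ N → (∀ x ∈ Icc a b, ZeroMeasureCondition c E B ∨ x ≠ 1 / 2) →
      simpleMeasure c N t E B ∈ Icc (volume.real (distAvg c a E B)) (volume.real (distAvg c b E B)) →
      ∃ x ∈ Icc (-N) N, volume.real (distAvg c x E B) = simpleMeasure c N t E B := by
    intro a b hab ha hb hz hT
    have hcont : ContinuousOn (fun x => volume.real (distAvg c x E B)) (Icc a b) := by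
      intro x hx
      refine (h.continuousAt_measureReal_distAvg ?_).continuousWithinAt
      by_cases hx2 : x = 1 / 2
      · rw [hx2]; exact (hz x hx).resolve_right (by simp [hx2])
      · exact h.volume_avgFun_eq_zero hx2
    obtain ⟨x, hx, hxT⟩ := intermediate_value_Icc hab hcont hT
    exact ⟨x, ⟨ha.trans hx.1, hx.2.trans hb⟩, hxT⟩
  rcases ht with hz | ht
  · exact ivt (-N) N (by linarith) le_rfl le_rfl (fun _ _ => Or.inl hz) hmem
  · rcases lt_or_ge t 0 with h0 | h0
    · refine ivt (-N) 0 (by linarith) le_rfl (by linarith)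
        (fun x hx => Or.inr (by linarith [hx.2])) ⟨hmem.1, ?_⟩
      rw [h.measureReal_distAvg_zero, ← h.simpleMeasure_zero hN]
      exact h.simpleMeasure_mono h0.le
    · have h1 : 1 < t := by
        by_contra h1
        exact ht ⟨h0, not_lt.1 h1⟩
      refine ivt 1 N hN.le (by linarith) le_rfl
        (fun x hx => Or.inr (by linarith [hx.1])) ⟨?_, hmem.2⟩
      rw [h.measureReal_distAvg_one, ← h.simpleMeasure_one hN]
      exact h.simpleMeasure_mono h1.le

lemma measureReal_distAvg_mem (h : IsSimplePair c E B) {x : ℝ} (hx : x ∈ Icc (-N) N) :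
    volume.real (distAvg c x E B) ∈ Icc (volume.real (distAvg c (-N) E B))
      (volume.real (distAvg c N E B)) :=
  ⟨h.measureReal_distAvg_mono hx.1, h.measureReal_distAvg_mono hx.2⟩

/-- The clamped target is the nearest value in the range and is attained, so minimizing means
attaining it. -/
lemma isReparam_iff (h : IsSimplePair c E B) (hN : 1 < N) {t : ℝ}
    (ht : ZeroMeasureCondition c E B ∨ t ∉ Icc (0 : ℝ) 1) {x : ℝ} :
    IsReparam c N t E B x ↔
      x ∈ Icc (-N) N ∧ volume.real (distAvg c x E B) = simpleMeasure c N t E B := by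
  constructor
  · rintro ⟨hx, hmin⟩
    refine ⟨hx, eq_clamp_of_abs_le (h.measureReal_distAvg_mem hx) ?_⟩
    obtain ⟨y, hy, hyT⟩ := h.exists_distAvg_measure_eq hN ht
    have := hmin hy
    simp only [mem_ofPred_eq] at this
    rw [hyT] at this
    exact this
  · rintro ⟨hx, hxT⟩
    refine ⟨hx, fun y hy => ?_⟩
    simp only [mem_ofPred_eq]
    rw [hxT]
    exact abs_clamp_sub_le (h.measureReal_distAvg_mem hy)

lemma volume_frontier_cthickening_inter (h : IsSimplePair c E B) (hB : B ≠ ∅) {r : ℝ}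
    (hr : 0 ≤ r) : volume (frontier (Metric.cthickening r B ∩ E)) = 0 := by
  refine volume_frontier_inter_eq_zero ?_ h.volume_frontier
  have hE := isEikonal_signedDist (h.frontier_right hB)
  have h0 : volume {p | signedDist B p = 0} = 0 := by
    refine measure_mono_null (fun p hp => ?_) h.regular.volume_frontier
    exact (signedDist_eq_zero_iff (h.frontier_right hB)).1 hp
  rw [cthickening_eq_signedDist h.regular.isClosed (h.frontier_right hB) hr]
  refine measure_mono_null (frontier_le_subset_eq continuous_const
    (continuous_const.add hE.continuous)) ?_
  refine measure_mono_null (fun p hp => ?_)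
    (volume_linear_comb_eq_zero hE h0 (G := 0) (by simp) (a := 1) (b := 0) (by simp) r)
  have hp' : 0 = r + signedDist B p := hp
  change 1 * signedDist B p + 0 * (0 : Space n → ℝ) p + r = 0
  linarith

lemma exists_cthickening_measure_eq (h : IsSimplePair c E B) (hB : B ≠ ∅) {t : ℝ}
    (ht : t ∈ Icc (0 : ℝ) 1) :
    ∃ r, 0 ≤ r ∧ volume.real (Metric.cthickening r B ∩ E) = targetMeasure t E B := by
  have hf := h.frontier_right hB
  have hE := isEikonal_signedDist hf
  have h0 : volume {p | signedDist B p = 0} = 0 := by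
    refine measure_mono_null (fun p hp => ?_) h.regular.volume_frontier
    exact (signedDist_eq_zero_iff hf).1 hp
  obtain ⟨b, hb⟩ := nonempty_iff_ne_empty.2 hB
  obtain ⟨R, hR⟩ := h.isBounded.subset_closedBall b
  have hR0 : 0 ≤ R := dist_nonneg.trans (hR (h.subset hb))
  have hcont : ContinuousOn (fun r => volume.real ({p | 0 ≤ r + signedDist B p} ∩ E)) (Icc 0 R) := by
    intro r _
    refine (continuousAt_measureReal_superlevel (f := fun r p => r + signedDist B p)
      (fun p => by fun_prop) (fun r => continuous_const.add hE.continuous) ?_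
      h.volume_ne_top).continuousWithinAt
    refine measure_mono_null (fun p hp => ?_)
      (volume_linear_comb_eq_zero hE h0 (G := 0) (by simp) (a := 1) (b := 0) (by simp) r)
    have hp' : r + signedDist B p = 0 := hp
    change 1 * signedDist B p + 0 * (0 : Space n → ℝ) p + r = 0
    linarith
  have hT : targetMeasure t E B ∈ Icc (volume.real ({p | 0 ≤ 0 + signedDist B p} ∩ E))
      (volume.real ({p | 0 ≤ R + signedDist B p} ∩ E)) := by
    rw [← cthickening_eq_signedDist h.regular.isClosed hf le_rfl,
      ← cthickening_eq_signedDist h.regular.isClosed hf hR0, Metric.cthickening_zero,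
      h.regular.isClosed.closure_eq, inter_eq_self_of_subset_left h.subset,
      inter_eq_self_of_subset_right fun p hp =>
        Metric.mem_cthickening_of_dist_le p b R B hb (hR hp)]
    have h0 := h.targetMeasure_mono ht.1
    have h1 := h.targetMeasure_mono ht.2
    simpa [targetMeasure] using And.intro h0 h1
  obtain ⟨r, hr, hrT⟩ := intermediate_value_Icc hR0 hcont hT
  refine ⟨r, hr.1, ?_⟩
  rw [cthickening_eq_signedDist h.regular.isClosed hf hr.1]
  exact hrT

lemma ne_empty_of_not_zeroMeasureCondition (h : IsSimplePair c E B)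
    (hz : ¬ ZeroMeasureCondition c E B) : B ≠ ∅ :=
  fun hB => hz (h.zeroMeasureCondition_of_eq_empty hB)

lemma exists_isPreAvg (h : IsSimplePair c E B) (hN : 1 < N) (t : ℝ) :
    ∃ W, IsPreAvg c N t E B W := by
  by_cases ht : ZeroMeasureCondition c E B ∨ t ∉ Icc (0 : ℝ) 1
  · obtain ⟨x, hx⟩ := h.exists_distAvg_measure_eq hN ht
    exact ⟨_, Or.inl ⟨ht, x, (h.isReparam_iff hN ht).2 hx, rfl⟩⟩
  · rw [not_or, not_not] at ht
    obtain ⟨r, hr, hrT⟩ :=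
      h.exists_cthickening_measure_eq (h.ne_empty_of_not_zeroMeasureCondition ht.1) ht.2
    exact ⟨_, Or.inr ⟨ht, r, hr, hrT, rfl⟩⟩

lemma isBounded_of_isPreAvg (h : IsSimplePair c E B) {t : ℝ} {W : Set (Space n)}
    (hW : IsPreAvg c N t E B W) : Bornology.IsBounded W := by
  rcases hW with ⟨_, x, _, rfl⟩ | ⟨_, r, _, _, rfl⟩
  · exact h.isBounded_distAvg x
  · exact h.isBounded.subset inter_subset_right

lemma measureReal_of_isPreAvg (h : IsSimplePair c E B) (hN : 1 < N) {t : ℝ} {W : Set (Space n)}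
    (hW : IsPreAvg c N t E B W) : volume.real W = simpleMeasure c N t E B := by
  rcases hW with ⟨ht, x, hx, rfl⟩ | ⟨ht, r, _, hr, rfl⟩
  · exact ((h.isReparam_iff hN ht).1 hx).2
  · rw [hr, h.simpleMeasure_eq hN ht.2]

/-- If the two sets come from different formulas, the one that is a distance average has parameter
below `0` or above `1`, so `B` or `E` separates them. The case `s = t` gives uniqueness up to null
sets. -/
lemma isPreAvg_ae_le (h : IsSimplePair c E B) (hN : 1 < N) {s t : ℝ} (hst : s ≤ t)
    {V W : Set (Space n)} (hV : IsPreAvg c N s E B V) (hW : IsPreAvg c N t E B W) :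
    V ≤ᵐ[volume] W := by
  have hVW : volume.real V ≤ volume.real W := by
    rw [h.measureReal_of_isPreAvg hN hV, h.measureReal_of_isPreAvg hN hW]
    exact h.simpleMeasure_mono hst
  rcases hV with ⟨hs, x, hx, rfl⟩ | ⟨hs, r, hr, hrs, rfl⟩ <;>
  rcases hW with ⟨ht, y, hy, rfl⟩ | ⟨ht, r', hr', hrt, rfl⟩
  · exact h.distAvg_ae_le hVW
  · have hs0 : s < 0 := by
      by_contra hs0
      exact hs.resolve_left ht.1 ⟨not_lt.1 hs0, hst.trans ht.2.2⟩
    have h1 : volume.real (distAvg c x E B) ≤ volume.real (distAvg c 0 E B) := by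
      rw [((h.isReparam_iff hN hs).1 hx).2, h.measureReal_distAvg_zero, ← h.simpleMeasure_zero hN]
      exact h.simpleMeasure_mono hs0.le
    exact (h.distAvg_ae_le h1).trans (h.distAvg_zero_ae_eq.le.trans
      (LE.le.eventuallyLE (h.subset_cthickening_inter r')))
  · have ht1 : 1 < t := by
      by_contra ht1
      exact ht.resolve_left hs.1 ⟨hs.2.1.trans hst, not_lt.1 ht1⟩
    have h1 : volume.real (distAvg c 1 E B) ≤ volume.real (distAvg c y E B) := by
      rw [((h.isReparam_iff hN ht).1 hy).2, h.measureReal_distAvg_one, ← h.simpleMeasure_one hN]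
      exact h.simpleMeasure_mono ht1.le
    exact (LE.le.eventuallyLE inter_subset_right).trans
      (h.distAvg_one_ae_eq.symm.le.trans (h.distAvg_ae_le h1))
  · exact h.cthickening_inter_ae_le hVW

lemma volume_frontier_of_isPreAvg (h : IsSimplePair c E B) (hN : 1 < N) {t : ℝ}
    {W : Set (Space n)} (hW : IsPreAvg c N t E B W) : volume (frontier W) = 0 := by
  rcases hW with ⟨ht, x, hx, rfl⟩ | ⟨ht, r, hr, -, rfl⟩
  · by_cases hx2 : x = 1 / 2
    · rcases ht with hz | ht
      · exact h.volume_frontier_distAvg (hx2 ▸ hz)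
      · have hm := ((h.isReparam_iff hN (Or.inr ht)).1 hx).2
        -- outside `[0, 1]` the weight `1 / 2` only occurs when the set is almost `B` or `E`
        rcases lt_or_ge t 0 with h0 | h0
        · have h1 : volume.real (distAvg c x E B) ≤ volume.real (distAvg c 0 E B) := by
            rw [hm, h.measureReal_distAvg_zero, ← h.simpleMeasure_zero hN]
            exact h.simpleMeasure_mono h0.le
          have h2 : distAvg c 0 E B ≤ᵐ[volume] distAvg c x E B :=
            LE.le.eventuallyLE (h.distAvg_mono (by rw [hx2]; norm_num))
          exact volume_frontier_eq_zero_of_ae_eq (h.isClosed_distAvg x)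
            (((h.distAvg_ae_le h1).antisymm h2).trans h.distAvg_zero_ae_eq)
            h.regular.volume_frontier
        · have ht1 : 1 < t := by
            by_contra ht1
            exact ht ⟨h0, not_lt.1 ht1⟩
          have h1 : volume.real (distAvg c 1 E B) ≤ volume.real (distAvg c x E B) := by
            rw [hm, h.measureReal_distAvg_one, ← h.simpleMeasure_one hN]
            exact h.simpleMeasure_mono ht1.le
          have h2 : distAvg c x E B ≤ᵐ[volume] distAvg c 1 E B :=
            LE.le.eventuallyLE (h.distAvg_mono (by rw [hx2]; norm_num))
          exact volume_frontier_eq_zero_of_ae_eq (h.isClosed_distAvg x)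
            ((h2.antisymm (h.distAvg_ae_le h1)).trans h.distAvg_one_ae_eq) h.volume_frontier
    · exact h.volume_frontier_distAvg (h.volume_avgFun_eq_zero hx2)
  · exact h.volume_frontier_cthickening_inter (h.ne_empty_of_not_zeroMeasureCondition ht.1) hr

lemma isPreAvg_zero_ae_eq (h : IsSimplePair c E B) (hN : 1 < N) {W : Set (Space n)}
    (hW : IsPreAvg c N 0 E B W) : W =ᵐ[volume] B := by
  have hm := h.measureReal_of_isPreAvg hN hW
  rw [h.simpleMeasure_zero hN] at hm
  rcases hW with ⟨_, x, _, rfl⟩ | ⟨_, r, _, _, rfl⟩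
  · rw [← h.measureReal_distAvg_zero] at hm
    exact ((h.distAvg_ae_le hm.le).antisymm (h.distAvg_ae_le hm.ge)).trans h.distAvg_zero_ae_eq
  · exact (ae_le_of_subset_of_measureReal_le (h.subset_cthickening_inter r)
      h.regular.measurableSet.nullMeasurableSet (h.volume_inter_ne_top _) hm.le).antisymm
      (LE.le.eventuallyLE (h.subset_cthickening_inter r))

lemma isPreAvg_one_ae_eq (h : IsSimplePair c E B) (hN : 1 < N) {W : Set (Space n)}
    (hW : IsPreAvg c N 1 E B W) : W =ᵐ[volume] E := by
  have hm := h.measureReal_of_isPreAvg hN hW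
  rw [h.simpleMeasure_one hN] at hm
  rcases hW with ⟨_, x, _, rfl⟩ | ⟨_, r, _, _, rfl⟩
  · rw [← h.measureReal_distAvg_one] at hm
    exact ((h.distAvg_ae_le hm.le).antisymm (h.distAvg_ae_le hm.ge)).trans h.distAvg_one_ae_eq
  · exact (LE.le.eventuallyLE inter_subset_right).antisymm
      (ae_le_of_subset_of_measureReal_le inter_subset_right
        (h.nullMeasurableSet_cthickening_inter r) h.volume_ne_top hm.ge)

/-- Simple averages of nested sets are well defined and form a one-parameter family. -/
lemma exists_isAvgFamily (h : IsSimplePair c E B) (hN : 1 < N) :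
    ∃ R, IsAvgFamily (fun t S => IsSimpleAvg c N t E B S) (ci E) B R := by
  choose W hW using h.exists_isPreAvg hN
  have hfr := fun t => h.volume_frontier_of_isPreAvg hN (hW t)
  have hreg : ∀ t, IsRegularCompactJordan (ci (W t)) := fun t =>
    isRegularCompactJordan_ci (h.isBounded_of_isPreAvg (hW t)) (hfr t)
  have hmono : Monotone fun t => ci (W t) := fun s t hst =>
    ci_subset_ci_of_ae_le (h.isPreAvg_ae_le hN hst (hW s) (hW t)) (hfr t)
  refine ⟨fun t => ci (W t), fun t S => ?_, hreg, hmono, ?_, ?_, fun s t hst => ?_⟩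
  · rw [isSimpleAvg_iff]
    constructor
    · rintro ⟨V, hV, rfl⟩
      -- Independence of the admissible parameter: the comparison is used with equal weights in both
      -- directions.
      exact Subset.antisymm (ci_subset_ci_of_ae_le (h.isPreAvg_ae_le hN le_rfl hV (hW t)) (hfr t))
        (ci_subset_ci_of_ae_le (h.isPreAvg_ae_le hN le_rfl (hW t) hV)
          (h.volume_frontier_of_isPreAvg hN hV))
    · rintro rfl
      exact ⟨W t, hW t, rfl⟩
  · have h0 := h.isPreAvg_zero_ae_eq hN (hW 0)
    conv_rhs => rw [h.regular.eq_ci]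
    exact Subset.antisymm (ci_subset_ci_of_ae_le h0.le h.regular.volume_frontier)
      (ci_subset_ci_of_ae_le h0.symm.le (hfr 0))
  · have h1 := h.isPreAvg_one_ae_eq hN (hW 1)
    exact Subset.antisymm (ci_subset_ci_of_ae_le h1.le h.volume_frontier)
      (ci_subset_ci_of_ae_le h1.symm.le (hfr 1))
  · rw [measureReal_sdiff_of_isRegularCompactJordan (hmono hst) (hreg s) (hreg t),
      measureReal_congr (ci_ae_eq (hfr s)), measureReal_congr (ci_ae_eq (hfr t)),
      measureReal_congr (ci_ae_eq h.volume_frontier),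
      h.measureReal_of_isPreAvg hN (hW s), h.measureReal_of_isPreAvg hN (hW t)]
    refine (clamp_sub_le (h.targetMeasure_mono hst)).trans_eq ?_
    simp only [targetMeasure]
    ring

end IsSimplePair

/-! ### Components of a difference -/

/-- `C` is a union of connected components of `D`. -/
def IsSaturated (D C : Set (Space n)) : Prop :=
  C ⊆ D ∧ ∀ S, IsPreconnected S → S ⊆ D → (S ∩ C).Nonempty → S ⊆ C

lemma isSaturated_of_mem_components {D C : Set (Space n)} (hC : C ∈ components D) :
    IsSaturated D C := by
  obtain ⟨p, hp, rfl⟩ := hC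
  refine ⟨connectedComponentIn_subset D p, fun S hS hSD ⟨x, hxS, hxC⟩ => ?_⟩
  rw [connectedComponentIn_eq hxC]
  exact hS.subset_connectedComponentIn hxS hSD

lemma isSaturated_sUnion {D : Set (Space n)} {𝒦 : Set (Set (Space n))}
    (h : ∀ C ∈ 𝒦, IsSaturated D C) : IsSaturated D (⋃₀ 𝒦) := by
  refine ⟨sUnion_subset fun C hC => (h C hC).1, fun S hS hSD ⟨x, hxS, C, hC, hxC⟩ => ?_⟩
  exact ((h C hC).2 S hS hSD ⟨x, hxS, hxC⟩).trans (subset_sUnion_of_mem hC)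

lemma isPreconnected_of_mem_components {D C : Set (Space n)} (hC : C ∈ components D) :
    IsPreconnected C := by
  obtain ⟨p, -, rfl⟩ := hC
  exact isPreconnected_connectedComponentIn

lemma nonempty_of_mem_components {D C : Set (Space n)} (hC : C ∈ components D) : C.Nonempty := by
  obtain ⟨p, hp, rfl⟩ := hC
  exact ⟨p, mem_connectedComponentIn hp⟩

lemma exists_mem_components {D : Set (Space n)} {p : Space n} (hp : p ∈ D) :
    ∃ C ∈ components D, p ∈ C :=
  ⟨_, ⟨p, hp, rfl⟩, mem_connectedComponentIn hp⟩

lemma eq_of_mem_components {D C C' : Set (Space n)} (hC : C ∈ components D)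
    (hC' : C' ∈ components D) {p : Space n} (hp : p ∈ C) (hp' : p ∈ C') : C = C' := by
  obtain ⟨q, -, rfl⟩ := hC
  obtain ⟨q', -, rfl⟩ := hC'
  rw [connectedComponentIn_eq hp, connectedComponentIn_eq hp']

/-- Components are relatively closed: a set between a connected set and its closure is connected. -/
lemma closure_inter_subset_of_mem_components {D C : Set (Space n)} (hC : C ∈ components D) :
    closure C ∩ D ⊆ C := by
  have hs := isSaturated_of_mem_components hC
  have hsub : C ⊆ closure C ∩ D := subset_inter subset_closure hs.1
  obtain ⟨p, hp⟩ := nonempty_of_mem_components hC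
  exact hs.2 _ ((isPreconnected_of_mem_components hC).subset_closure hsub inter_subset_left)
    inter_subset_right ⟨p, hsub hp, hp⟩

section Difference

variable {A B : Set (Space n)}

/-- Around an interior point of `A` off `B` some ball lies in `A \ B`; being connected, it lies in
`C` or misses it, so the point is not in the frontier. -/
lemma frontier_union_subset_of_isSaturated (hA : IsClosed A) (hB : IsClosed B) (hBA : B ⊆ A)
    {C : Set (Space n)} (hC : IsSaturated (A \ B) C) :
    frontier (B ∪ C) ⊆ frontier A ∪ frontier B := by
  have hsub : B ∪ C ⊆ A := union_subset hBA (hC.1.trans sdiff_subset)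
  rintro p ⟨hp1, hp2⟩
  have hpA : p ∈ A := closure_minimal hsub hA hp1
  by_cases hpi : p ∈ interior A
  · by_cases hpB : p ∈ B
    · exact Or.inr ⟨subset_closure hpB, fun h => hp2 (interior_mono subset_union_left h)⟩
    · exfalso
      have hopen : IsOpen (interior A \ B) := isOpen_interior.sdiff hB
      obtain ⟨r, hr, hball⟩ := Metric.isOpen_iff.1 hopen p ⟨hpi, hpB⟩
      have hballD : Metric.ball p r ⊆ A \ B :=
        hball.trans (sdiff_subset_sdiff_left interior_subset)
      obtain ⟨q, hq, hqBC⟩ := Metric.mem_closure_iff.1 hp1 r hr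
      have hqb : q ∈ Metric.ball p r := by rwa [Metric.mem_ball, dist_comm]
      have hqC : q ∈ C := hq.resolve_left (hballD hqb).2
      have hbC := hC.2 _ (convex_ball p r).isPreconnected hballD ⟨q, hqb, hqC⟩
      exact hp2 (interior_maximal (hbC.trans subset_union_right) Metric.isOpen_ball
        (Metric.mem_ball_self hr))
  · exact Or.inl ⟨subset_closure hpA, hpi⟩

/-- Removing finitely many relatively closed components leaves a relatively open part of `A`, which
meets the interior of `A` because that is dense in `A`. -/
lemma interior_nonempty_of_sdiff_components (hA : IsRegularCompactJordan A) (hB : IsClosed B)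
    {𝒦 : Set (Set (Space n))} (h𝒦 : 𝒦 ⊆ components (A \ B)) (hfin : 𝒦.Finite)
    (hne : ((A \ B) \ ⋃₀ 𝒦).Nonempty) : (interior ((A \ B) \ ⋃₀ 𝒦)).Nonempty := by
  obtain ⟨p, hp, hpK⟩ := hne
  have hcl : closure (⋃₀ 𝒦) ∩ (A \ B) ⊆ ⋃₀ 𝒦 := by
    rw [sUnion_eq_biUnion, hfin.closure_biUnion]
    rintro q ⟨hq, hqD⟩
    obtain ⟨C, hC, hqC⟩ := mem_iUnion₂.1 hq
    exact mem_iUnion₂.2 ⟨C, hC, closure_inter_subset_of_mem_components (h𝒦 hC) ⟨hqC, hqD⟩⟩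
  have hpc : p ∉ closure (⋃₀ 𝒦) := fun h => hpK (hcl ⟨h, hp⟩)
  have hopen : IsOpen ((closure (⋃₀ 𝒦))ᶜ ∩ Bᶜ) :=
    isClosed_closure.isOpen_compl.inter hB.isOpen_compl
  have hpA : p ∈ closure (interior A) := by
    have := hp.1
    rwa [hA.eq_ci] at this
  obtain ⟨q, hq, hqA⟩ := mem_closure_iff.1 hpA _ hopen ⟨hpc, hp.2⟩
  refine ⟨q, interior_maximal ?_ (hopen.inter isOpen_interior) ⟨hq, hqA⟩⟩
  rintro x ⟨⟨hx1, hx2⟩, hx3⟩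
  exact ⟨⟨interior_subset hx3, hx2⟩, fun h => hx1 (subset_closure h)⟩

variable {ε : ℝ}

lemma isSaturated_of_mem_pieces {C : Set (Space n)} (hC : C ∈ pieces ε A B) :
    IsSaturated (A \ B) C := by
  unfold pieces at hC
  split_ifs at hC with hfin
  · exact isSaturated_of_mem_components hC
  · rcases hC with hC | rfl
    · exact isSaturated_of_mem_components hC.1
    · exact isSaturated_sUnion fun C hC => isSaturated_of_mem_components hC.1

lemma sUnion_pieces : ⋃₀ pieces ε A B = A \ B := by
  refine Subset.antisymm (sUnion_subset fun C hC => (isSaturated_of_mem_pieces hC).1) fun p hp => ?_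
  obtain ⟨C, hC, hpC⟩ := exists_mem_components hp
  unfold pieces
  split_ifs with hfin
  · exact ⟨C, hC, hpC⟩
  · rcases le_or_gt (ENNReal.ofReal ε) (volume C) with h | h
    · exact ⟨C, Or.inl ⟨hC, h⟩, hpC⟩
    · exact ⟨_, Or.inr rfl, C, ⟨hC, h⟩, hpC⟩

lemma pairwiseDisjoint_pieces : (pieces ε A B).PairwiseDisjoint id := by
  intro C hC C' hC' hne
  rw [Function.onFun, disjoint_left]
  intro p hp hp'
  simp only [id] at hp hp'
  unfold pieces at hC hC'
  split_ifs at hC hC' with hfin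
  · exact hne (eq_of_mem_components hC hC' hp hp')
  · rcases hC with hC | rfl <;> rcases hC' with hC' | rfl
    · exact hne (eq_of_mem_components hC.1 hC'.1 hp hp')
    · obtain ⟨K, hK, hpK⟩ := hp'
      have := eq_of_mem_components hC.1 hK.1 hp hpK
      exact absurd hC.2 (not_le.2 (this ▸ hK.2))
    · obtain ⟨K, hK, hpK⟩ := hp
      have := eq_of_mem_components hC'.1 hK.1 hp' hpK
      exact absurd hC'.2 (not_le.2 (this ▸ hK.2))
    · exact hne rfl

lemma volume_frontier_union_eq_zero (hA : IsRegularCompactJordan A)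
    (hB : IsRegularCompactJordan B) (hBA : B ⊆ A) {C : Set (Space n)}
    (hC : IsSaturated (A \ B) C) : volume (frontier (B ∪ C)) = 0 :=
  measure_mono_null (frontier_union_subset_of_isSaturated hA.isClosed hB.isClosed hBA hC)
    (measure_union_null hA.volume_frontier hB.volume_frontier)

lemma nullMeasurableSet_of_isSaturated (hA : IsRegularCompactJordan A)
    (hB : IsRegularCompactJordan B) (hBA : B ⊆ A) {C : Set (Space n)}
    (hC : IsSaturated (A \ B) C) : NullMeasurableSet C := by
  have h1 : C = (B ∪ C) \ B := by
    rw [union_sdiff_left, eq_comm]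
    exact (disjoint_left.2 fun p hp => (hC.1 hp).2).sdiff_eq_left
  rw [h1]
  have h2 : NullMeasurableSet (B ∪ C) :=
    nullMeasurableSet_of_null_frontier (volume_frontier_union_eq_zero hA hB hBA hC)
  exact h2.diff hB.measurableSet.nullMeasurableSet

lemma finite_large_components (hε : 0 < ε) (hA : IsRegularCompactJordan A)
    (hB : IsRegularCompactJordan B) (hBA : B ⊆ A) :
    {C | C ∈ components (A \ B) ∧ ENNReal.ofReal ε ≤ volume C}.Finite := by
  have := Measure.finite_const_le_meas_of_disjoint_iUnion₀ (μ := (volume : Measure (Space n)))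
    (ENNReal.ofReal_pos.2 hε) (As := fun C : components (A \ B) => (C : Set (Space n)))
    (fun C => nullMeasurableSet_of_isSaturated hA hB hBA (isSaturated_of_mem_components C.2))
    (fun C C' hne => Disjoint.aedisjoint (disjoint_left.2 fun p hp hp' =>
      hne (Subtype.ext (eq_of_mem_components C.2 C'.2 hp hp'))))
    (ne_top_of_le_ne_top hA.volume_ne_top (measure_mono (iUnion_subset fun C =>
      (isSaturated_of_mem_components C.2).1.trans sdiff_subset)))
  refine (this.image Subtype.val).subset ?_
  rintro C ⟨hC, hCε⟩
  exact ⟨⟨C, hC⟩, hCε, rfl⟩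

lemma finite_pieces (hε : 0 < ε) (hA : IsRegularCompactJordan A)
    (hB : IsRegularCompactJordan B) (hBA : B ⊆ A) : (pieces ε A B).Finite := by
  unfold pieces
  split_ifs with hfin
  · exact hfin
  · exact (finite_large_components hε hA hB hBA).union (finite_singleton _)

/-- With finitely many components, and for the residual union, the piece contains what is left after
removing finitely many components. A large component has positive measure, while a set with null
frontier and empty interior is null. -/
lemma interior_union_piece_nonempty (hε : 0 < ε) (hA : IsRegularCompactJordan A)
    (hB : IsRegularCompactJordan B) (hBA : B ⊆ A) {C : Set (Space n)}
    (hC : C ∈ pieces ε A B) : (interior (B ∪ C)).Nonempty := by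
  have hsat := isSaturated_of_mem_pieces hC
  unfold pieces at hC
  split_ifs at hC with hfin
  · have hsub : (A \ B) \ ⋃₀ (components (A \ B) \ {C}) ⊆ C := by
      rintro p ⟨hp, hpK⟩
      obtain ⟨K, hK, hpK'⟩ := exists_mem_components hp
      by_contra hpC
      exact hpK ⟨K, ⟨hK, fun h => hpC (h ▸ hpK')⟩, hpK'⟩
    obtain ⟨p, hp⟩ := nonempty_of_mem_components hC
    refine (interior_nonempty_of_sdiff_components hA hB.isClosed sdiff_subset
      (hfin.subset sdiff_subset) ⟨p, hsat.1 hp, ?_⟩).mono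
      (interior_mono (hsub.trans subset_union_right))
    rintro ⟨K, ⟨hK, hKC⟩, hpK⟩
    exact hKC (eq_of_mem_components hK hC hpK hp)
  · rcases hC with hC | hC
    · by_contra hempty
      rw [not_nonempty_iff_eq_empty] at hempty
      have h1 := measure_congr
        (interior_ae_eq_of_null_frontier (volume_frontier_union_eq_zero hA hB hBA hsat))
      rw [hempty, measure_empty] at h1
      have h2 : volume C = 0 := measure_mono_null subset_union_right h1.symm
      have h3 := hC.2
      rw [h2] at h3
      exact absurd h3 (not_le.2 (ENNReal.ofReal_pos.2 hε))
    · have hlarge := finite_large_components hε hA hB hBA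
      obtain ⟨K, hK, hKs⟩ := (Set.Infinite.sdiff hfin hlarge).nonempty
      obtain ⟨p, hp⟩ := nonempty_of_mem_components hK
      have hsub : (A \ B) \ ⋃₀ {C | C ∈ components (A \ B) ∧ ENNReal.ofReal ε ≤ volume C} ⊆ C := by
        rintro q ⟨hq, hqK⟩
        obtain ⟨L, hL, hqL⟩ := exists_mem_components hq
        have hC' : C = ⋃₀ {C | C ∈ components (A \ B) ∧ volume C < ENNReal.ofReal ε} := hC
        rw [hC']
        refine ⟨L, ⟨hL, ?_⟩, hqL⟩
        by_contra h
        exact hqK ⟨L, ⟨hL, not_lt.1 h⟩, hqL⟩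
      refine (interior_nonempty_of_sdiff_components hA hB.isClosed (fun C hC => hC.1) hlarge
        ⟨p, (isSaturated_of_mem_components hK).1 hp, ?_⟩).mono
        (interior_mono (hsub.trans subset_union_right))
      rintro ⟨L, hL, hpL⟩
      exact hKs (eq_of_mem_components hK hL.1 hp hpL ▸ hL)

variable {c : Set (Space n) → Space n} {N : ℝ}

lemma isSimplePair_of_mem_pieces (hc : IsCenterChoice c) (hε : 0 < ε)
    (hA : IsRegularCompactJordan A) (hB : IsRegularCompactJordan B) (hBA : B ⊆ A)
    {C : Set (Space n)} (hC : C ∈ pieces ε A B) : IsSimplePair c (B ∪ C) B where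
  subset := subset_union_left
  regular := hB
  isBounded := hA.isBounded.subset
    (union_subset hBA ((isSaturated_of_mem_pieces hC).1.trans sdiff_subset))
  volume_frontier := volume_frontier_union_eq_zero hA hB hBA (isSaturated_of_mem_pieces hC)
  interior_nonempty := interior_union_piece_nonempty hε hA hB hBA hC
  isCenterChoice := hc

lemma pieces_nonempty (hBA : B ⊆ A) (hne : A ≠ B) : (pieces ε A B).Nonempty := by
  by_contra h
  rw [not_nonempty_iff_eq_empty] at h
  have := sUnion_pieces (ε := ε) (A := A) (B := B)
  rw [h, sUnion_empty, eq_comm, sdiff_eq_empty] at this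
  exact hne (this.antisymm hBA)

/-- The measures of the pieces of `A \ B` add up to that of `A \ B`. -/
lemma sum_measureReal_pieces (hA : IsRegularCompactJordan A) (hB : IsRegularCompactJordan B)
    (hBA : B ⊆ A) (hfin : (pieces ε A B).Finite) :
    ∑ C ∈ hfin.toFinset, (volume.real (ci (B ∪ C)) - volume.real B)
      = volume.real A - volume.real B := by
  have h2 : ∀ C ∈ hfin.toFinset, volume C ≠ ⊤ := fun C hC =>
    ne_top_of_le_ne_top hA.volume_ne_top (measure_mono
      ((isSaturated_of_mem_pieces (hfin.mem_toFinset.1 hC)).1.trans sdiff_subset))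
  have h1 : ∀ C ∈ hfin.toFinset, volume.real (ci (B ∪ C)) - volume.real B = volume.real C := by
    intro C hC
    have hC' := isSaturated_of_mem_pieces (hfin.mem_toFinset.1 hC)
    rw [measureReal_congr (ci_ae_eq (volume_frontier_union_eq_zero hA hB hBA hC')),
      measureReal_union' (disjoint_left.2 fun p hp hpC => (hC'.1 hpC).2 hp) hB.measurableSet
        hB.volume_ne_top (h2 C hC)]
    ring
  rw [Finset.sum_congr rfl h1, ← measureReal_biUnion_finset₀ (f := fun C => C) ?_ ?_ h2]
  · have : ⋃ C ∈ hfin.toFinset, C = A \ B := by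
      rw [← sUnion_pieces (ε := ε), sUnion_eq_biUnion]
      simp
    rw [this, measureReal_sdiff_of_isRegularCompactJordan hBA hB hA]
  · intro C hC C' hC' hne
    exact (pairwiseDisjoint_pieces (hfin.mem_toFinset.1 hC) (hfin.mem_toFinset.1 hC') hne).aedisjoint
  · exact fun C hC => nullMeasurableSet_of_isSaturated hA hB hBA
      (isSaturated_of_mem_pieces (hfin.mem_toFinset.1 hC))

end Difference

/-! ### Averages of nested sets -/

lemma isAvgFamily_const {A : Set (Space n)} (hA : IsRegularCompactJordan A)
    {P : ℝ → Set (Space n) → Prop} (hP : ∀ t S, P t S ↔ S = A) :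
    IsAvgFamily P A A fun _ => A :=
  ⟨hP, fun _ => hA, fun _ _ _ => le_rfl, rfl, rfl, fun s t _ => by simp⟩

/-- Measure averages of nested sets are well defined and form a one-parameter family. -/
lemma exists_isAvgFamily_isNestedAvg [NeZero n] {c : Set (Space n) → Space n}
    (hc : IsCenterChoice c) {N ε : ℝ} (hN : 1 < N) (hε : 0 < ε) {A B : Set (Space n)}
    (hA : IsRegularCompactJordan A) (hB : IsRegularCompactJordan B) (hBA : B ⊆ A) :
    ∃ R, IsAvgFamily (fun t S => IsNestedAvg c N ε t A B S) A B R := by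
  by_cases hAB : A = B
  · subst hAB
    exact ⟨_, isAvgFamily_const hA fun t S => by simp [IsNestedAvg]⟩
  have hfin := finite_pieces hε hA hB hBA
  have hne := pieces_nonempty (ε := ε) hBA hAB
  set 𝒞 := pieces ε A B with h𝒞
  have hpair : ∀ C ∈ 𝒞, IsSimplePair c (B ∪ C) B := fun C hC =>
    isSimplePair_of_mem_pieces hc hε hA hB hBA hC
  have hex : ∀ C : Set (Space n), ∃ R, C ∈ 𝒞 →
      IsAvgFamily (fun t S => IsSimpleAvg c N t (B ∪ C) B S) (ci (B ∪ C)) B R := by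
    intro C
    by_cases hC : C ∈ 𝒞
    · obtain ⟨R, hR⟩ := (hpair C hC).exists_isAvgFamily hN
      exact ⟨R, fun _ => hR⟩
    · exact ⟨fun _ => ∅, fun h => absurd h hC⟩
  choose R hR using hex
  set M : ℝ → Set (Space n) := fun t =>
    if 0 ≤ t then ⋃ C ∈ 𝒞, R C t else ci (⋂ C ∈ 𝒞, R C t) with hM
  have hMpos : ∀ t, 0 ≤ t → M t = ⋃ C ∈ 𝒞, R C t := fun t ht => by simp [hM, ht]
  have hMneg : ∀ t, t < 0 → M t = ci (⋂ C ∈ 𝒞, R C t) := fun t ht => by simp [hM, not_le.2 ht]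
  obtain ⟨C₀, hC₀⟩ := hne
  have hfr : ∀ t, volume (frontier (⋂ C ∈ 𝒞, R C t)) = 0 := fun t =>
    volume_frontier_biInter_eq_zero hfin fun C hC => ((hR C hC).regular t).volume_frontier
  have hM0 : M 0 = B := by
    rw [hMpos 0 le_rfl]
    refine Subset.antisymm (iUnion₂_subset fun C hC => (hR C hC).zero.subset) ?_
    exact (hR C₀ hC₀).zero.symm.subset.trans (subset_iUnion₂_of_subset C₀ hC₀ Subset.rfl)
  have hI0 : ⋂ C ∈ 𝒞, R C 0 = B := by
    refine Subset.antisymm ((iInter₂_subset C₀ hC₀).trans (hR C₀ hC₀).zero.subset) ?_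
    exact subset_iInter₂ fun C hC => (hR C hC).zero.symm.subset
  -- At `t = 0` the union and the intersection formulas both give `B`, so the two half-lines can be
  -- joined there.
  have hMnonpos : ∀ t, t ≤ 0 → M t = ci (⋂ C ∈ 𝒞, R C t) := by
    intro t ht
    rcases ht.lt_or_eq with h | rfl
    · exact hMneg t h
    · rw [hM0, hI0]; exact hB.eq_ci
  have hreg : ∀ t, IsRegularCompactJordan (M t) := by
    intro t
    rcases le_or_gt 0 t with ht | ht
    · rw [hMpos t ht]
      exact IsRegularCompactJordan.biUnion hfin fun C hC => (hR C hC).regular t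
    · rw [hMneg t ht]
      exact isRegularCompactJordan_ci
        (((hR C₀ hC₀).regular t).isBounded.subset (iInter₂_subset C₀ hC₀)) (hfr t)
  have hmono : Monotone M := by
    have hpos : ∀ s t, 0 ≤ s → s ≤ t → M s ⊆ M t := fun s t hs hst => by
      rw [hMpos s hs, hMpos t (hs.trans hst)]
      exact iUnion₂_mono fun C hC => (hR C hC).mono hst
    have hneg : ∀ s t, t ≤ 0 → s ≤ t → M s ⊆ M t := fun s t ht hst => by
      rw [hMnonpos s (hst.trans ht), hMnonpos t ht]
      exact ci_mono (iInter₂_mono fun C hC => (hR C hC).mono hst)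
    intro s t hst
    rcases le_total 0 s with hs | hs
    · exact hpos s t hs hst
    · rcases le_total t 0 with ht | ht
      · exact hneg s t ht hst
      · exact (hneg s 0 le_rfl hs).trans (hpos 0 t le_rfl ht)
  have hM1 : M 1 = A := by
    refine Subset.antisymm ?_ ?_
    · rw [hMpos 1 zero_le_one]
      refine iUnion₂_subset fun C hC => ?_
      rw [(hR C hC).one]
      refine (ci_subset_closure _).trans (closure_minimal ?_ hA.isClosed)
      exact union_subset hBA ((isSaturated_of_mem_pieces hC).1.trans sdiff_subset)
    -- Each `ci (B ∪ C)` misses only a null part of `B ∪ C`, and a regular set almost contained in a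
    -- closed set is contained in it.
    · refine hA.subset_of_ae_le (hreg 1).isClosed (ae_le_set.2 ?_)
      have hsub : A \ M 1 ⊆ ⋃ C ∈ 𝒞, (B ∪ C) \ ci (B ∪ C) := by
        rintro p ⟨hpA, hpM⟩
        have hpB : p ∉ B := fun h => hpM (hmono zero_le_one (hM0.symm ▸ h))
        have hpD : p ∈ ⋃₀ 𝒞 := by rw [h𝒞, sUnion_pieces]; exact ⟨hpA, hpB⟩
        obtain ⟨C, hC, hpC⟩ := hpD
        refine mem_iUnion₂.2 ⟨C, hC, Or.inr hpC, fun h => hpM ?_⟩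
        rw [hMpos 1 zero_le_one]
        exact mem_iUnion₂.2 ⟨C, hC, (hR C hC).one.symm ▸ h⟩
      refine measure_mono_null hsub ((measure_biUnion_null_iff hfin.countable).2 fun C hC => ?_)
      exact ae_le_set.1 (ci_ae_eq (hpair C hC).volume_frontier).symm.le
  refine ⟨M, fun t S => ?_, hreg, hmono, hM0, hM1, ?_⟩
  · simp only [IsNestedAvg, hAB, if_false]
    constructor
    · rintro ⟨R', hR', rfl⟩
      have heq : ∀ C ∈ 𝒞, R' C = R C t := fun C hC => ((hR C hC).iff t _).1 (hR' C hC)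
      simp only [hM]
      rw [iUnion₂_congr heq, iInter₂_congr heq]
    · rintro rfl
      exact ⟨fun C => R C t, fun C hC => ((hR C hC).iff t _).2 rfl, rfl⟩
  -- Differences of unions and differences of intersections are both covered by the piecewise
  -- differences, whose rates add up over the pieces.
  · have hsum : ∀ s t, s ≤ t → volume.real (⋃ C ∈ hfin.toFinset, R C t \ R C s) ≤
        (t - s) * (volume.real A - volume.real B) := by
      intro s t hst
      refine (measureReal_biUnion_finset_le _ _).trans ?_
      rw [← sum_measureReal_pieces hA hB hBA hfin, Finset.mul_sum]
      exact Finset.sum_le_sum fun C hC =>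
        (hR C (hfin.mem_toFinset.1 hC)).measure_diff_le s t hst
    have htop : ∀ s t, volume (⋃ C ∈ hfin.toFinset, R C t \ R C s) ≠ ⊤ := fun s t =>
      (measure_biUnion_lt_top hfin.toFinset.finite_toSet fun C hC =>
        (((hR C (hfin.mem_toFinset.1 hC)).regular t).isBounded.subset
          sdiff_subset).measure_lt_top).ne
    have hpos : ∀ s t, 0 ≤ s → s ≤ t →
        volume.real (M t \ M s) ≤ (t - s) * (volume.real A - volume.real B) := by
      intro s t hs hst
      refine (measureReal_mono ?_ (htop s t)).trans (hsum s t hst)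
      rw [hMpos s hs, hMpos t (hs.trans hst)]
      rintro p ⟨hp1, hp2⟩
      obtain ⟨C, hC, hpC⟩ := mem_iUnion₂.1 hp1
      exact mem_iUnion₂.2 ⟨C, hfin.mem_toFinset.2 hC, hpC,
        fun h => hp2 (mem_iUnion₂.2 ⟨C, hC, h⟩)⟩
    have hneg : ∀ s t, t ≤ 0 → s ≤ t →
        volume.real (M t \ M s) ≤ (t - s) * (volume.real A - volume.real B) := by
      intro s t ht hst
      have hae : (ci (⋂ C ∈ 𝒞, R C t) \ ci (⋂ C ∈ 𝒞, R C s) : Set (Space n)) =ᵐ[volume]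
          ((⋂ C ∈ 𝒞, R C t) \ (⋂ C ∈ 𝒞, R C s) : Set (Space n)) :=
        ae_eq_set_sdiff (ci_ae_eq (hfr t)) (ci_ae_eq (hfr s))
      rw [hMnonpos s (hst.trans ht), hMnonpos t ht, measureReal_congr hae]
      refine (measureReal_mono ?_ (htop s t)).trans (hsum s t hst)
      rintro p ⟨hp1, hp2⟩
      have hp2' : ∃ C ∈ 𝒞, p ∉ R C s := by
        by_contra! h
        exact hp2 (mem_iInter₂.2 h)
      obtain ⟨C, hC, hpC⟩ := hp2'
      exact mem_iUnion₂.2 ⟨C, hfin.mem_toFinset.2 hC, mem_iInter₂.1 hp1 C hC, hpC⟩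
    intro s t hst
    rcases le_total 0 s with hs | hs
    · exact hpos s t hs hst
    · rcases le_total t 0 with ht | ht
      · exact hneg s t ht hst
      · have h1 := hneg s 0 le_rfl hs
        have h2 := hpos 0 t le_rfl ht
        rw [measureReal_sdiff_of_isRegularCompactJordan (hmono hs) (hreg _) (hreg _)] at h1
        rw [measureReal_sdiff_of_isRegularCompactJordan (hmono ht) (hreg _) (hreg _)] at h2
        rw [measureReal_sdiff_of_isRegularCompactJordan (hmono hst) (hreg _) (hreg _)]
        linarith

/-! ### Averages of general sets -/

lemma dMu_comm (A B : Set (Space n)) : dMu A B = dMu B A := by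
  rw [dMu, dMu, symmDiff_comm]

lemma dMu_triangle {A B C : Set (Space n)} (hA : IsRegularCompactJordan A)
    (hB : IsRegularCompactJordan B) : dMu A C ≤ dMu A B + dMu B C :=
  measureReal_symmDiff_le C hA.volume_ne_top hB.volume_ne_top

lemma dMu_congr {A A' B B' : Set (Space n)} (hA : A =ᵐ[volume] A') (hB : B =ᵐ[volume] B') :
    dMu A B = dMu A' B' :=
  measureReal_congr (ae_eq_set_symmDiff hA hB)

section

variable {A B : Set (Space n)}

lemma ci_inter_subset (hA : IsRegularCompactJordan A) (hB : IsRegularCompactJordan B) :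
    ci (A ∩ B) ⊆ A ∩ B :=
  (ci_subset_closure _).trans (hA.isClosed.inter hB.isClosed).closure_eq.subset

lemma volume_frontier_inter (hA : IsRegularCompactJordan A) (hB : IsRegularCompactJordan B) :
    volume (frontier (A ∩ B)) = 0 :=
  volume_frontier_inter_eq_zero hA.volume_frontier hB.volume_frontier

lemma isRegularCompactJordan_ci_inter (hA : IsRegularCompactJordan A)
    (hB : IsRegularCompactJordan B) : IsRegularCompactJordan (ci (A ∩ B)) :=
  isRegularCompactJordan_ci (hA.isBounded.subset inter_subset_left) (volume_frontier_inter hA hB)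

lemma dMu_eq (hA : IsRegularCompactJordan A) (hB : IsRegularCompactJordan B) :
    dMu A B = (volume.real A - volume.real (ci (A ∩ B)))
      + (volume.real B - volume.real (ci (A ∩ B))) := by
  have hA' := hA.volume_ne_top
  have hB' := hB.volume_ne_top
  rw [measureReal_congr (ci_ae_eq (volume_frontier_inter hA hB)), dMu,
    measureReal_symmDiff_eq hA.measurableSet hB.measurableSet]
  have h1 := measureReal_sdiff_add_inter (s := A) hB.measurableSet hA'
  have h2 := measureReal_sdiff_add_inter (s := B) hA.measurableSet hB'
  rw [inter_comm] at h2
  linarith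

/-- For nonnegative weights, the measure average of general sets is well defined and has the
interpolation, submetric, measure and inclusion properties. -/
lemma exists_isNonnegAvg [NeZero n] {c : Set (Space n) → Space n} (hc : IsCenterChoice c)
    {N ε : ℝ} (hN : 1 < N) (hε : 0 < ε) (hA : IsRegularCompactJordan A)
    (hB : IsRegularCompactJordan B) :
    ∃ M : ℝ → Set (Space n), (∀ t S, IsNonnegAvg c N ε t A B S ↔ S = M t) ∧
      (∀ t, IsRegularCompactJordan (M t)) ∧ M 0 = B ∧ M 1 = A ∧
      (∀ s t, 0 ≤ s → s ≤ t → dMu (M s) (M t) ≤ (t - s) * dMu A B) ∧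
      (∀ t ∈ Icc (0 : ℝ) 1, volume.real (M t) = t * volume.real A + (1 - t) * volume.real B) ∧
      (∀ t ∈ Icc (0 : ℝ) 1, ci (A ∩ B) ⊆ M t ∧ M t ⊆ A ∪ B) := by
  have hI := isRegularCompactJordan_ci_inter hA hB
  have hIsub := ci_inter_subset hA hB
  have hIae := ci_ae_eq (volume_frontier_inter hA hB)
  obtain ⟨R₁, h₁⟩ := exists_isAvgFamily_isNestedAvg hc hN hε hA hI (hIsub.trans inter_subset_left)
  obtain ⟨R₂, h₂⟩ := exists_isAvgFamily_isNestedAvg hc hN hε hB hI (hIsub.trans inter_subset_right)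
  set I := ci (A ∩ B) with hIdef
  set M : ℝ → Set (Space n) := fun t =>
    if t ≤ 1 then R₁ t ∪ R₂ (1 - t) else ci (R₁ t \ (A ∩ B)) ∪ R₂ (1 - t) with hM
  -- Dropping `ci` changes `M t` by a null set for `t ≥ 1`, including `t = 1`, where `M` is defined
  -- by the other formula. Symmetric differences of the unregularized sets are easy to locate.
  set M' : ℝ → Set (Space n) := fun t => (R₁ t \ (A ∩ B)) ∪ R₂ (1 - t) with hM'
  have hMle : ∀ t, t ≤ 1 → M t = R₁ t ∪ R₂ (1 - t) := fun t ht => by simp [hM, ht]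
  have hMgt : ∀ t, 1 < t → M t = ci (R₁ t \ (A ∩ B)) ∪ R₂ (1 - t) := fun t ht => by
    simp [hM, not_le.2 ht]
  have hM0 : M 0 = B := by
    rw [hMle 0 zero_le_one, h₁.zero, sub_zero, h₂.one]
    exact union_eq_self_of_subset_left (hIsub.trans inter_subset_right)
  have hM1 : M 1 = A := by
    rw [hMle 1 le_rfl, h₁.one, sub_self, h₂.zero]
    exact union_eq_self_of_subset_right (hIsub.trans inter_subset_left)
  have hfr : ∀ t, volume (frontier (R₁ t \ (A ∩ B))) = 0 := fun t => by
    rw [sdiff_eq]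
    refine volume_frontier_inter_eq_zero (h₁.regular t).volume_frontier ?_
    rw [frontier_compl]
    exact volume_frontier_inter hA hB
  have hreg : ∀ t, IsRegularCompactJordan (M t) := by
    intro t
    rcases le_or_gt t 1 with ht | ht
    · rw [hMle t ht]; exact (h₁.regular t).union (h₂.regular _)
    · rw [hMgt t ht]
      exact (isRegularCompactJordan_ci ((h₁.regular t).isBounded.subset sdiff_subset)
        (hfr t)).union (h₂.regular _)
  have hMM' : ∀ t, 1 ≤ t → M t =ᵐ[volume] M' t := by
    intro t ht
    rcases ht.lt_or_eq with h | rfl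
    · rw [hMgt t h]
      exact ae_eq_set_union (ci_ae_eq (hfr t)) EventuallyEq.rfl
    · rw [hM1]
      have : M' 1 = (A \ (A ∩ B)) ∪ I := by simp only [hM', h₁.one, sub_self, h₂.zero]
      rw [this]
      have h3 : (A \ (A ∩ B)) ∪ (A ∩ B) = A := sdiff_union_of_subset inter_subset_left
      conv_lhs => rw [← h3]
      exact ae_eq_set_union EventuallyEq.rfl hIae.symm
  -- As the parameter increases, `R₁` grows and `R₂` shrinks; the two rates sum to `d_μ(A, B)` by
  -- `dMu_eq`.
  have hbound : ∀ s t, s ≤ t → ∀ X Y : Set (Space n),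
      symmDiff X Y ⊆ (R₁ t \ R₁ s) ∪ (R₂ (1 - s) \ R₂ (1 - t)) →
      dMu X Y ≤ (t - s) * dMu A B := by
    intro s t hst X Y hXY
    have h3 : volume ((R₁ t \ R₁ s) ∪ (R₂ (1 - s) \ R₂ (1 - t))) ≠ ⊤ :=
      (((h₁.regular t).isBounded.subset sdiff_subset).union
        ((h₂.regular _).isBounded.subset sdiff_subset)).measure_lt_top.ne
    have h4 := h₁.measure_diff_le s t hst
    have h5 := h₂.measure_diff_le (1 - t) (1 - s) (by linarith)
    refine (measureReal_mono hXY h3).trans ((measureReal_union_le _ _).trans ?_)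
    rw [dMu_eq hA hB]
    calc _ ≤ _ := add_le_add h4 h5
      _ = _ := by ring
  have hsub_le : ∀ s t, 0 ≤ s → s ≤ t → t ≤ 1 → dMu (M s) (M t) ≤ (t - s) * dMu A B := by
    intro s t _ hst ht
    refine hbound s t hst _ _ ?_
    rw [hMle s (hst.trans ht), hMle t ht]
    have m1 := h₁.mono hst
    have m2 : R₂ (1 - t) ⊆ R₂ (1 - s) := h₂.mono (by linarith)
    rintro p (⟨hp1 | hp1, hp2⟩ | ⟨hp1 | hp1, hp2⟩)
    · exact absurd (Or.inl (m1 hp1)) hp2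
    · exact Or.inr ⟨hp1, fun h => hp2 (Or.inr h)⟩
    · exact Or.inl ⟨hp1, fun h => hp2 (Or.inl h)⟩
    · exact absurd (Or.inr (m2 hp1)) hp2
  have hsub_ge : ∀ s t, 1 ≤ s → s ≤ t → dMu (M s) (M t) ≤ (t - s) * dMu A B := by
    intro s t hs hst
    rw [dMu_congr (hMM' s hs) (hMM' t (hs.trans hst))]
    refine hbound s t hst _ _ ?_
    have m1 := h₁.mono hst
    have m2 : R₂ (1 - t) ⊆ R₂ (1 - s) := h₂.mono (by linarith)
    rintro p (⟨hp1 | hp1, hp2⟩ | ⟨hp1 | hp1, hp2⟩)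
    · exact absurd (Or.inl ⟨m1 hp1.1, hp1.2⟩) hp2
    · exact Or.inr ⟨hp1, fun h => hp2 (Or.inr h)⟩
    · exact Or.inl ⟨hp1.1, fun h => hp2 (Or.inl ⟨h, hp1.2⟩)⟩
    · exact absurd (Or.inr (m2 hp1)) hp2
  have hmem : ∀ t ∈ Icc (0 : ℝ) 1,
      I ⊆ R₁ t ∧ R₁ t ⊆ A ∧ I ⊆ R₂ (1 - t) ∧ R₂ (1 - t) ⊆ B := by
    intro t ht
    refine ⟨?_, ?_, ?_, ?_⟩
    · exact h₁.zero.symm.subset.trans (h₁.mono ht.1)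
    · exact (h₁.mono ht.2).trans h₁.one.subset
    · exact h₂.zero.symm.subset.trans (h₂.mono (by linarith [ht.2]))
    · exact (h₂.mono (by linarith [ht.1])).trans h₂.one.subset
  refine ⟨M, fun t S => ?_, hreg, hM0, hM1, ?_, ?_, ?_⟩
  · constructor
    · rintro ⟨S₁, S₂, hS₁, hS₂, rfl⟩
      rw [(h₁.iff t S₁).1 hS₁, (h₂.iff (1 - t) S₂).1 hS₂]
    · rintro rfl
      exact ⟨R₁ t, R₂ (1 - t), (h₁.iff t _).2 rfl, (h₂.iff (1 - t) _).2 rfl, rfl⟩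
  · intro s t hs hst
    rcases le_total t 1 with ht | ht
    · exact hsub_le s t hs hst ht
    · rcases le_total 1 s with hs1 | hs1
      · exact hsub_ge s t hs1 hst
      · have h3 := hsub_le s 1 hs hs1 le_rfl
        have h4 := hsub_ge 1 t le_rfl ht
        have h5 := dMu_triangle (C := M t) (hreg s) (hreg 1)
        linarith
  · intro t ht
    obtain ⟨hI1, h1A, hI2, h2B⟩ := hmem t ht
    have h3 := measureReal_union_add_inter (s := R₁ t) (h₂.regular (1 - t)).measurableSet
      (h₁.regular t).volume_ne_top (h₂.regular (1 - t)).volume_ne_top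
    -- The overlap lies between `ci (A ∩ B)` and `A ∩ B`, which differ by a null set;
    -- inclusion-exclusion then gives the measure.
    have h4 : volume.real (R₁ t ∩ R₂ (1 - t)) = volume.real I := by
      refine measureReal_congr (EventuallyLE.antisymm ?_ ?_)
      · exact (LE.le.eventuallyLE (inter_subset_inter h1A h2B)).trans hIae.symm.le
      · exact LE.le.eventuallyLE (subset_inter hI1 hI2)
    rw [hMle t ht.2]
    rw [h4, h₁.measure_eq ht, h₂.measure_eq ⟨by linarith [ht.2], by linarith [ht.1]⟩] at h3
    linarith
  · intro t ht
    obtain ⟨hI1, h1A, -, h2B⟩ := hmem t ht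
    rw [hMle t ht.2]
    exact ⟨hI1.trans subset_union_left, union_subset_union h1A h2B⟩

end

end MeasureAverage

end

/-! ### Joining nonnegative and negative parameters -/

theorem theorem4p1 {n : ℕ} (hn : 1 ≤ n)
    (c : Set (MeasureAverage.Space n) → MeasureAverage.Space n)
    (hc : MeasureAverage.IsCenterChoice c)
    (N : ℝ) (hN : 1 < N) (ε : ℝ) (hε : 0 < ε)
    (A B : Set (MeasureAverage.Space n))
    (hA : MeasureAverage.IsRegularCompactJordan A)
    (hB : MeasureAverage.IsRegularCompactJordan B) :
    ∃ M : ℝ → Set (MeasureAverage.Space n),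
      -- for every real `t`, the construction yields exactly one set, `M t`
      (∀ (t : ℝ) (S : Set (MeasureAverage.Space n)),
        MeasureAverage.IsMeasureAvg c N ε t A B S ↔ S = M t) ∧
      (∀ t : ℝ, MeasureAverage.IsRegularCompactJordan (M t)) ∧
      M 0 = B ∧ M 1 = A ∧
      (∀ s t : ℝ,
        MeasureAverage.dMu (M s) (M t) ≤ |t - s| * MeasureAverage.dMu A B) ∧
      (∀ t ∈ Set.Icc (0 : ℝ) 1,
        MeasureTheory.volume.real (M t) =
          t * MeasureTheory.volume.real A + (1 - t) * MeasureTheory.volume.real B) ∧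
      (∀ s ∈ Set.Icc (0 : ℝ) 1, ∀ t ∈ Set.Icc (0 : ℝ) 1,
        MeasureAverage.dMu (M s) (M t) = |t - s| * MeasureAverage.dMu A B) ∧
      (∀ t ∈ Set.Icc (0 : ℝ) 1,
        MeasureAverage.ci (A ∩ B) ⊆ M t ∧ M t ⊆ A ∪ B) := by
  open MeasureAverage in
  have : NeZero n := ⟨by omega⟩
  obtain ⟨P, hP, hPreg, hP0, hP1, hPlip, hPm, hPi⟩ := exists_isNonnegAvg hc hN hε hA hB
  obtain ⟨Q, hQ, hQreg, hQ0, hQ1, hQlip, -, -⟩ := exists_isNonnegAvg hc hN hε hB hA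
  -- The two branches agree at `t = 0`, where both equal `B`, so the Lipschitz bounds of the
  -- half-lines chain through that point.
  set M : ℝ → Set (Space n) := fun t => if t < 0 then Q (1 - t) else P t with hM
  have hMneg : ∀ t, t < 0 → M t = Q (1 - t) := fun t ht => by simp [hM, ht]
  have hMpos : ∀ t, 0 ≤ t → M t = P t := fun t ht => by simp [hM, not_lt.2 ht]
  have hMnonpos : ∀ t, t ≤ 0 → M t = Q (1 - t) := by
    intro t ht
    rcases ht.lt_or_eq with h | rfl
    · exact hMneg t h
    · rw [hMpos 0 le_rfl, hP0, sub_zero, hQ1]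
  have hreg : ∀ t, IsRegularCompactJordan (M t) := by
    intro t
    rcases lt_or_ge t 0 with ht | ht
    · rw [hMneg t ht]; exact hQreg _
    · rw [hMpos t ht]; exact hPreg _
  have hM0 : M 0 = B := by rw [hMpos 0 le_rfl, hP0]
  have hM1 : M 1 = A := by rw [hMpos 1 zero_le_one, hP1]
  have hpos : ∀ s t, 0 ≤ s → s ≤ t → dMu (M s) (M t) ≤ (t - s) * dMu A B := by
    intro s t hs hst
    rw [hMpos s hs, hMpos t (hs.trans hst)]
    exact hPlip s t hs hst
  have hneg : ∀ s t, t ≤ 0 → s ≤ t → dMu (M s) (M t) ≤ (t - s) * dMu A B := by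
    intro s t ht hst
    rw [hMnonpos s (hst.trans ht), hMnonpos t ht, dMu_comm, dMu_comm A B]
    refine (hQlip (1 - t) (1 - s) (by linarith) (by linarith)).trans_eq ?_
    ring
  have hlip : ∀ s t, s ≤ t → dMu (M s) (M t) ≤ (t - s) * dMu A B := by
    intro s t hst
    rcases le_total 0 s with hs | hs
    · exact hpos s t hs hst
    · rcases le_total t 0 with ht | ht
      · exact hneg s t ht hst
      · have h1 := hneg s 0 le_rfl hs
        have h2 := hpos 0 t le_rfl ht
        have h3 := dMu_triangle (C := M t) (hreg s) (hreg 0)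
        linarith
  have heq : ∀ s t, 0 ≤ s → s ≤ t → t ≤ 1 → dMu (M s) (M t) = (t - s) * dMu A B := by
    intro s t hs hst ht
    -- A shortfall on `[s, t]` would make the path from `B` to `A` through `M s` and `M t` shorter
    -- than `d_μ(A, B)`.
    refine le_antisymm (hlip s t hst) ?_
    have h1 := hlip 0 s hs
    have h2 := hlip t 1 ht
    have h3 := dMu_triangle (C := M 1) (hreg 0) (hreg s)
    have h4 := dMu_triangle (C := M 1) (hreg s) (hreg t)
    have h5 : dMu (M 0) (M 1) = dMu A B := by rw [hM0, hM1, dMu_comm]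
    linarith
  refine ⟨M, fun t S => ?_, hreg, hM0, hM1, fun s t => ?_, fun t ht => ?_,
    fun s hs t ht => ?_, fun t ht => ?_⟩
  · rcases lt_or_ge t 0 with ht | ht
    · simp only [IsMeasureAvg, ht, if_true, hMneg t ht]
      exact hQ (1 - t) S
    · simp only [IsMeasureAvg, not_lt.2 ht, if_false, hMpos t ht]
      exact hP t S
  · rcases le_total s t with hst | hst
    · rw [abs_of_nonneg (by linarith)]; exact hlip s t hst
    · rw [abs_sub_comm, abs_of_nonneg (by linarith), dMu_comm]; exact hlip t s hst
  · rw [hMpos t ht.1]; exact hPm t ht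
  · rcases le_total s t with hst | hst
    · rw [abs_of_nonneg (by linarith)]; exact heq s t hs.1 hst ht.2
    · rw [abs_sub_comm, abs_of_nonneg (by linarith), dMu_comm]; exact heq t s ht.1 hst hs.2
  · rw [hMpos t ht.1]; exact hPi t ht
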